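/- Consider $N$ plants $\dot x_i = A_i x_i + B_i u_i + w_i$ with known deterministic inputs $u_i$ and $M$ sensors with measurements $y_{ij}=C_{ij}x_i+v_{ij}$, where $w_i$, $v_{ij}$ are independent zero-mean stationary white Gaussian noises with power spectral densities $W_i\succeq 0$ and $V_{ij}\succ 0$, and the initial states are independent of each other and of the noises, with covariances $\Sigma_{i,0}\succ0$. Let $T_i\succeq 0$ be weights and $\kappa_{ij}\in\mathbb R$ measurement costs. Assume that for each $i$ there is a set of sensors for which the pair formed by $A_i$ and the stacked matrix of the corresponding $C_{ij}$ is detectable, and that $(A_i,W_i^{1/2})$ is controllable. Let $P=[p_{ij}]$ be a matrix of optimal parameters of the semidefinite program $$\inf_{R,Q,p}\ \sum_{i=1}^N\Big(\operatorname{Tr}(T_iR_i)+\sum_{j=1}^M\kappa_{ij}p_{ij}\Big)$$ subject to, for all $i,j$, $$\begin{bmatrix}R_i&I\\ I&Q_i\end{bmatrix}\succ0,\qquad \begin{bmatrix}Q_iA_i+A_i^TQ_i-\sum_{j}p_{ij}C_{ij}^TV_{ij}^{-1}C_{ij}&Q_iW_i^{1/2}\\ W_i^{1/2}Q_i&-I\end{bmatrix}\preceq0,$$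 $$0\le p_{ij}\le1,\qquad \sum_{i}p_{ij}\le1,\qquad \sum_{j}p_{ij}\le1,$$ meaning that $P$ is feasible together with some $(R,Q)$ and that the infimum over $(R,Q)$ with $P$ fixed equals the optimal value of the program. Let $\tilde P$ be the square matrix of size $\max(N,M)$ obtained from $P$ by adding zero rows or zero columns, and let $\tilde P=\sum_{k=1}^K\phi_kP_k$ with $\phi_k>0$, $\sum_k\phi_k=1$, where each $P_k$ is a $0$-$1$ matrix with at most one unit in each row and in each column. For $\epsilon>0$, the periodic switching policy of period $\epsilon$ lets sensor $j$ observe plant $i$ at time $t$ (that is, $\pi_{ij}(t)=1$, and $\pi_{ij}(t)=0$ otherwise) if and only if $(P_k)_{ij}=1$, where $k$ is the index with $(l+\phi_1+\dots+\phi_{k-1})\epsilon\le t<(l+\phi_1+\dots+\phi_k)\epsilon$ for some integer $l$. Put $C_i^\epsilon(t)=V_{ij}^{-1/2}C_{ij}$ if sensor $j$ observes plant $i$ at time $t$, and $C_i^\epsilon(t)=0$ if no sensor does. Let $\Sigma_i^\epsilon$ be the error covariance of the Kalman–Bucy filter of plant $i$ under this policy, i.e. the solution on $[0,\infty)$ of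 the $\epsilon$-periodic Riccati equation $$\dot\Sigma=A_i\Sigma+\Sigma A_i^T+W_i-\Sigma\, C_i^\epsilon(t)^TC_i^\epsilon(t)\,\Sigma,\qquad \Sigma(0)=\Sigma_{i,0}$$ (solutions are continuous and satisfy the equation with the right derivative at the switching times). Then, for every $\epsilon>0$ and every $i\in\{1,\dots,N\}$: 1. the periodic pair $(A_i,C_i^\epsilon(\cdot))$ is detectable, i.e. there is a continuous $\epsilon$-periodic $K(\cdot)$ such that all characteristic multipliers of $\dot x=(A_i-K(t)C_i^\epsilon(t))x$ lie in the open unit disk, where $C_i^\epsilon(t)$ is written with one block of rows for each sensor (zero for sensors not observing plant $i$ at time $t$); 2. the solution $\Sigma_i^\epsilon$ exists on $[0,\infty)$; 3. the periodic Riccati equation has a unique strong periodic solution $\bar\Sigma_i^\epsilon$, i.e. a unique $\epsilon$-periodic symmetric positive semidefinite solution on $\mathbb R$ such that all characteristic multipliers of $A_i-\bar\Sigma_i^\epsilon(t)C_i^\epsilon(t)^TC_i^\epsilon(t)$ lie in the closed unit disk, and $$\lim_{t\to\infty}\big(\Sigma_i^\epsilon(t)-\bar\Sigma_i^\epsilon(t)\big)=0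 .$$ -/

import Mathlib

open Filter Topology Set
open scoped Matrix MatrixOrder

noncomputable section

namespace SensorScheduling

/-! ### Linear time-invariant pairs -/

/-- The real square matrix `F` is Hurwitz: all its complex eigenvalues have negative real part. -/
def IsHurwitz {n : ℕ} (F : Matrix (Fin n) (Fin n) ℝ) : Prop :=
  ∀ μ ∈ spectrum ℂ (F.map (algebraMap ℝ ℂ)), μ.re < 0

/-- The pair `(A, C)` is detectable: some output injection `L` makes `A - L C` Hurwitz. -/
def IsDetectable {n : ℕ} {ι : Type} [Fintype ι]
    (A : Matrix (Fin n) (Fin n) ℝ) (C : Matrix ι (Fin n) ℝ) : Prop :=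
  ∃ L : Matrix (Fin n) ι ℝ, IsHurwitz (A - L * C)

/-- The pair `(A, B)` is controllable: the columns of `B, A B, …, A ^ (n - 1) B` span the state
space. -/
def IsControllable {n : ℕ} {ι : Type} [Fintype ι]
    (A : Matrix (Fin n) (Fin n) ℝ) (B : Matrix (Fin n) ι ℝ) : Prop :=
  Submodule.span ℝ {v : Fin n → ℝ | ∃ k < n, ∃ w : ι → ℝ, v = (A ^ k * B) *ᵥ w} = ⊤

/-! ### Periodic linear systems with piecewise continuous, right-continuous coefficients

Differential equations with such coefficients are read as follows: the solution is continuous and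
has at every time the right derivative prescribed by the equation. Away from the jumps of the
coefficients this is the equation in the usual sense. -/

/-- `Φ` is the fundamental matrix on `[0, ∞)` of `ẋ(t) = F(t) x(t)`, normalised by `Φ(0) = I`. -/
def IsFundamentalMatrix {n : ℕ} (F Φ : ℝ → Matrix (Fin n) (Fin n) ℝ) : Prop :=
  Φ 0 = 1 ∧ ContinuousOn Φ (Ici 0) ∧
    ∀ t, 0 ≤ t → HasDerivWithinAt Φ (F t * Φ t) (Ici t) t

/-- All characteristic multipliers of the `τ`-periodic system `ẋ(t) = F(t) x(t)`, that is, all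
complex eigenvalues of its monodromy matrix `Φ(τ)`, satisfy the predicate `p`. -/
def MultipliersSatisfy {n : ℕ} (τ : ℝ) (F : ℝ → Matrix (Fin n) (Fin n) ℝ) (p : ℂ → Prop) : Prop :=
  ∃ Φ : ℝ → Matrix (Fin n) (Fin n) ℝ, IsFundamentalMatrix F Φ ∧
    ∀ μ ∈ spectrum ℂ ((Φ τ).map (algebraMap ℝ ℂ)), p μ

/-- The `τ`-periodic pair `(A, C(·))` is detectable: there is a `τ`-periodic output injection
`K(·)` for which `ẋ(t) = (A - K(t) C(t)) x(t)` is asymptotically stable, that is, has all its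
characteristic multipliers in the open unit disk. -/
def IsPeriodicDetectable {n : ℕ} {ι : Type} [Fintype ι] (τ : ℝ)
    (A : Matrix (Fin n) (Fin n) ℝ) (C : ℝ → Matrix ι (Fin n) ℝ) : Prop :=
  ∃ K : ℝ → Matrix (Fin n) ι ℝ, Continuous K ∧ Function.Periodic K τ ∧
    MultipliersSatisfy τ (fun t => A - K t * C t) (fun μ => ‖μ‖ < 1)

/-- The right-hand side `A X + X Aᵀ + W - X G X` of the Riccati differential equation. -/
def riccati {n : ℕ} (A W G X : Matrix (Fin n) (Fin n) ℝ) : Matrix (Fin n) (Fin n) ℝ :=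
  A * X + X * Aᵀ + W - X * G * X

/-- `X` is a strong periodic solution of the `τ`-periodic Riccati differential equation
`Ẋ = A X + X Aᵀ + W - X C(t)ᵀ C(t) X`: a `τ`-periodic symmetric positive semidefinite solution on
the whole time axis such that the characteristic multipliers of `A - X(t) C(t)ᵀ C(t)` lie in the
closed unit disk. -/
structure IsStrongPeriodicSolution {n : ℕ} {ι : Type} [Fintype ι] (τ : ℝ)
    (A W : Matrix (Fin n) (Fin n) ℝ) (C : ℝ → Matrix ι (Fin n) ℝ)
    (X : ℝ → Matrix (Fin n) (Fin n) ℝ) : Prop where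
  continuous : Continuous X
  periodic : Function.Periodic X τ
  posSemidef : ∀ t, (X t).PosSemidef
  deriv_right : ∀ t, HasDerivWithinAt X (riccati A W ((C t)ᵀ * C t) (X t)) (Ici t) t
  multipliers : MultipliersSatisfy τ (fun t => A - X t * ((C t)ᵀ * C t)) (fun μ => ‖μ‖ ≤ 1)

/-! ### The sensor scheduling model -/

/-- The data of the scheduling problem with `N` plants and `M` sensors. Plant `i` has state
dimension `n i`, sensor `j` applied to plant `i` has output dimension `m i j`. -/
structure Model (N M : ℕ) where
  n : Fin N → ℕ
  m : Fin N → Fin M → ℕ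
  /-- dynamics -/
  A : ∀ i, Matrix (Fin (n i)) (Fin (n i)) ℝ
  /-- process noise power spectral density -/
  W : ∀ i, Matrix (Fin (n i)) (Fin (n i)) ℝ
  /-- covariance of the initial state -/
  Sigma0 : ∀ i, Matrix (Fin (n i)) (Fin (n i)) ℝ
  /-- observation matrices -/
  C : ∀ i j, Matrix (Fin (m i j)) (Fin (n i)) ℝ
  /-- measurement noise power spectral density -/
  V : ∀ i j, Matrix (Fin (m i j)) (Fin (m i j)) ℝ
  /-- weights of the estimation errors -/
  T : ∀ i, Matrix (Fin (n i)) (Fin (n i)) ℝ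
  /-- measurement costs -/
  κ : Fin N → Fin M → ℝ

namespace Model

variable {N M : ℕ} (D : Model N M)

/-- The stacked observation matrix of plant `i` for the sensors in `J`. -/
def stackedC (i : Fin N) (J : Finset (Fin M)) :
    Matrix ((j : J) × Fin (D.m i j)) (Fin (D.n i)) ℝ :=
  fun r c => D.C i r.1 r.2 c

/-- The standing assumptions on the data. -/
structure Assumptions : Prop where
  W_posSemidef : ∀ i, (D.W i).PosSemidef
  V_posDef : ∀ i j, (D.V i j).PosDef
  T_posSemidef : ∀ i, (D.T i).PosSemidef
  Sigma0_posDef : ∀ i, (D.Sigma0 i).PosDef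
  detectable : ∀ i, ∃ J : Finset (Fin M), IsDetectable (D.A i) (D.stackedC i J)
  controllable : ∀ i, IsControllable (D.A i) (CFC.sqrt (D.W i))

/-- The information matrix `∑ j, q j • C_{ij}ᵀ V_{ij}⁻¹ C_{ij}` of plant `i` for the sensor
weights `q`. -/
def information (i : Fin N) (q : Fin M → ℝ) : Matrix (Fin (D.n i)) (Fin (D.n i)) ℝ :=
  ∑ j, q j • ((D.C i j)ᵀ * (D.V i j)⁻¹ * D.C i j)

/-! ### The semidefinite relaxation -/

/-- Feasibility of `(R, Q, P)` for the semidefinite program. -/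
structure IsFeasible (R Q : ∀ i, Matrix (Fin (D.n i)) (Fin (D.n i)) ℝ)
    (P : Matrix (Fin N) (Fin M) ℝ) : Prop where
  inverse_lmi : ∀ i, (Matrix.fromBlocks (R i) 1 1 (Q i)).PosDef
  riccati_lmi : ∀ i, (-(Matrix.fromBlocks
      (Q i * D.A i + (D.A i)ᵀ * Q i - D.information i (P i)) (Q i * CFC.sqrt (D.W i))
      (CFC.sqrt (D.W i) * Q i) (-1))).PosSemidef
  nonneg : ∀ i j, 0 ≤ P i j
  le_one : ∀ i j, P i j ≤ 1
  sum_plants_le : ∀ j, ∑ i, P i j ≤ 1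
  sum_sensors_le : ∀ i, ∑ j, P i j ≤ 1

/-- The objective `∑ i, (Tr (T_i R_i) + ∑ j, κ_{ij} p_{ij})` of the semidefinite program. -/
def objective (R : ∀ i, Matrix (Fin (D.n i)) (Fin (D.n i)) ℝ) (P : Matrix (Fin N) (Fin M) ℝ) : ℝ :=
  ∑ i, ((D.T i * R i).trace + ∑ j, D.κ i j * P i j)

/-- `P` is a matrix of optimal parameters of the semidefinite program: it is feasible, and
minimising over `(R, Q)` with `P` held fixed gives the optimal value of the program. The infimum
over `(R, Q)` is not required to be attained (because of the strict inequality in the first matrix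
inequality it usually is not). -/
def IsOptimal (P : Matrix (Fin N) (Fin M) ℝ) : Prop :=
  (∃ R Q, D.IsFeasible R Q P) ∧
    ∀ R₁ Q₁ P₁, D.IsFeasible R₁ Q₁ P₁ → ∀ η > 0,
      ∃ R Q, D.IsFeasible R Q P ∧ D.objective R P < D.objective R₁ P₁ + η

end Model

/-! ### The periodic switching policies -/

/-- The square matrix of size `max N M` obtained from `P` by adding zero rows (dummy plants) or
zero columns (dummy sensors). -/
def padded {N M : ℕ} (P : Matrix (Fin N) (Fin M) ℝ) :
    Matrix (Fin (max N M)) (Fin (max N M)) ℝ :=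
  fun a b => if h : a.1 < N ∧ b.1 < M then P ⟨a.1, h.1⟩ ⟨b.1, h.2⟩ else 0

/-- Matrices with at most one unit in each row and in each column, all other entries zero. -/
structure IsAssignment {L : ℕ} (B : Matrix (Fin L) (Fin L) ℝ) : Prop where
  zero_or_one : ∀ a b, B a b = 0 ∨ B a b = 1
  row : ∀ a b₁ b₂, B a b₁ = 1 → B a b₂ = 1 → b₁ = b₂
  col : ∀ a₁ a₂ b, B a₁ b = 1 → B a₂ b = 1 → a₁ = a₂

/-- A decomposition `P̃ = ∑ k, φ_k P_k` of the padded matrix of `P` as a convex combination, with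
positive coefficients, of assignment matrices. -/
structure Decomposition {N M : ℕ} (P : Matrix (Fin N) (Fin M) ℝ) where
  K : ℕ
  φ : Fin K → ℝ
  B : Fin K → Matrix (Fin (max N M)) (Fin (max N M)) ℝ
  φ_pos : ∀ k, 0 < φ k
  φ_sum : ∑ k, φ k = 1
  B_assignment : ∀ k, IsAssignment (B k)
  sum_eq : padded P = ∑ k, φ k • B k

namespace Decomposition

variable {N M : ℕ} {P : Matrix (Fin N) (Fin M) ℝ} (S : Decomposition P)

/-- At time `t` the policy of period `ε` uses the `k`-th assignment, that is, for some integer `l`,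
`(l + φ_1 + ⋯ + φ_{k-1}) ε ≤ t < (l + φ_1 + ⋯ + φ_k) ε`. -/
def IsActive (ε t : ℝ) (k : Fin S.K) : Prop :=
  ∃ l : ℤ, (l + ∑ k₁ ∈ Finset.Iio k, S.φ k₁) * ε ≤ t ∧ t < (l + ∑ k₁ ∈ Finset.Iic k, S.φ k₁) * ε

open Classical in
/-- The switching policy of period `ε`: `policy ε i j t` is `1` if sensor `j` observes plant `i` at
time `t`, and `0` otherwise. -/
def policy (ε : ℝ) (i : Fin N) (j : Fin M) (t : ℝ) : ℝ :=
  ∑ k, if S.IsActive ε t k then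
    S.B k (Fin.castLE (le_max_left N M) i) (Fin.castLE (le_max_right N M) j) else 0

end Decomposition

namespace Model

variable {N M : ℕ} (D : Model N M) {P : Matrix (Fin N) (Fin M) ℝ} (S : Decomposition P)

/-- `X` is the covariance `Σ_i^ε` of the estimation error of the Kalman–Bucy filter of plant `i`
under the switching policy of period `ε`: the solution on `[0, ∞)` of
`Ẋ = A_i X + X A_iᵀ + W_i - X (∑ j, π_{ij}(t) C_{ij}ᵀ V_{ij}⁻¹ C_{ij}) X`, `X(0) = Σ_{i,0}`. -/
structure IsErrorCovariance (ε : ℝ) (i : Fin N)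
    (X : ℝ → Matrix (Fin (D.n i)) (Fin (D.n i)) ℝ) : Prop where
  initial : X 0 = D.Sigma0 i
  continuousOn : ContinuousOn X (Ici 0)
  deriv_right : ∀ t, 0 ≤ t → HasDerivWithinAt X
    (riccati (D.A i) (D.W i) (D.information i fun j => S.policy ε i j t) (X t)) (Ici t) t

/-- The periodic output matrix `C_i^ε(t) = V_{ij}^{-1/2} C_{ij}`, where `j` is the sensor observing
plant `i` at time `t`. The sensors may have outputs of different dimensions, so the matrix is
written with one block of rows for every sensor; the blocks of the sensors which do not observe
plant `i` at time `t` are zero. -/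
def outputMatrix (ε : ℝ) (i : Fin N) (t : ℝ) :
    Matrix ((j : Fin M) × Fin (D.m i j)) (Fin (D.n i)) ℝ :=
  fun r c => S.policy ε i r.1 t * (CFC.sqrt (D.V i r.1)⁻¹ * D.C i r.1) r.2 c

end Model

end SensorScheduling

end

noncomputable section

namespace SensorScheduling

/-! Fix a plant, let `G(t)` be its switched information matrix and `Γ` the information matrix of the
weights `P i`. A Schur complement turns feasibility into some `Q ≻ 0` with `Q A + Aᵀ Q + Q W Q ⪯ Γ`,
and `Γ` is the average of `G` over a period. Comparing the periodic equation with the averaged one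
would need a short period; the following argument works for every period `τ`.

Suppose `G(t) exp(tA) x = 0` throughout one period. Since `G` is constant on switching intervals of
positive length, analyticity makes every constituent information matrix, hence `Γ`, vanish along
`exp(tA) x` for all `t`. Along such a trajectory the inequality makes the form `Q` nonincreasing,
and controllability makes it drop strictly over a period (`quad_exp_lt`). Finsler's lemma gives `Q -
exp(τA)ᵀ Q exp(τA) + c O(τ) ≻ 0`, where `O` is the observability Gramian of `G`
(`IsSwitching.exists_gramian_ge`). Transport by `exp(-tA)` and scaling then produce a subsolution
`P` of the equation for `X⁻¹` with `P(τ) ⪰ P(0)`, so the Riccati solution started at `P(0)⁻¹`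
satisfies `X(τ) ⪯ X(0)` (`IsSwitching.exists_decreasing`).

Riccati solutions exist on the whole half-line (`IsSwitching.exists_closedLoop`) and depend
monotonically on the initial value, so `X(kτ)` decreases to the initial value of a periodic solution
`Z` (`ClosedLoop.exists_periodic`). Controllability makes the form of `Z` grow strictly under the
adjoint closed loop. Hence `A - Z G` is asymptotically stable (`ClosedLoop.multipliers`), which is
the detectability claim with a gain built from `Z`, and `Z` attracts all solutions with positive
definite initial value (`ClosedLoop.tendsto_sub`). A strong periodic solution is positive definite,
thus attracted by `Z`, and by periodicity equal to it. -/

/-! ### Functions on the half-line with prescribed right derivatives -/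

/-- `f` is continuous on `[0, ∞)` and has there the right derivative `f'`. -/
structure HasRightDeriv {E : Type*} [AddCommGroup E] [Module ℝ E] [TopologicalSpace E]
    [ContinuousSMul ℝ E] (f f' : ℝ → E) : Prop where
  cont : ContinuousOn f (Ici 0)
  deriv : ∀ t, 0 ≤ t → HasDerivWithinAt f (f' t) (Ici t) t

theorem hasDerivWithinAt_Ici_comp_add {E : Type*} [NormedAddCommGroup E] [NormedSpace ℝ E]
    {f : ℝ → E} {f' : E} {t a : ℝ} (h : HasDerivWithinAt f f' (Ici (t + a)) (t + a)) :
    HasDerivWithinAt (fun s => f (s + a)) f' (Ici t) t := by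
  have h2 : HasDerivWithinAt (fun s : ℝ => s + a) 1 (Ici t) t :=
    (hasDerivWithinAt_id t _).add_const a
  simpa [Function.comp_def] using h.scomp t h2 fun s hs => by
    simp only [mem_Ici] at *; linarith

namespace HasRightDeriv

section General

variable {E : Type*} [NormedAddCommGroup E] [NormedSpace ℝ E] {f f' g g' : ℝ → E}

theorem continuousOn_Icc (h : HasRightDeriv f f') (T : ℝ) : ContinuousOn f (Icc 0 T) :=
  h.cont.mono Icc_subset_Ici_self

theorem shift (h : HasRightDeriv f f') {a : ℝ} (ha : 0 ≤ a) :
    HasRightDeriv (fun t => f (t + a)) (fun t => f' (t + a)) := by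
  refine ⟨h.cont.comp (by fun_prop) fun t ht => ?_, fun t ht => ?_⟩
  · simp only [mem_Ici] at *; linarith
  · exact hasDerivWithinAt_Ici_comp_add (h.deriv (t + a) (by linarith))

theorem congr_deriv (h : HasRightDeriv f f') (hf : ∀ t, 0 ≤ t → f' t = g' t) :
    HasRightDeriv f g' :=
  ⟨h.cont, fun t ht => hf t ht ▸ h.deriv t ht⟩

theorem sub (hf : HasRightDeriv f f') (hg : HasRightDeriv g g') :
    HasRightDeriv (fun t => f t - g t) (fun t => f' t - g' t) :=
  ⟨hf.cont.sub hg.cont, fun t ht => (hf.deriv t ht).sub (hg.deriv t ht)⟩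

theorem add (hf : HasRightDeriv f f') (hg : HasRightDeriv g g') :
    HasRightDeriv (fun t => f t + g t) (fun t => f' t + g' t) :=
  ⟨hf.cont.add hg.cont, fun t ht => (hf.deriv t ht).add (hg.deriv t ht)⟩

theorem clm {F : Type*} [NormedAddCommGroup F] [NormedSpace ℝ F] (h : HasRightDeriv f f')
    (l : E →L[ℝ] F) : HasRightDeriv (fun t => l (f t)) (fun t => l (f' t)) :=
  ⟨l.continuous.comp_continuousOn h.cont, fun t ht =>
    (l.hasFDerivAt.comp_hasDerivWithinAt t (h.deriv t ht))⟩

/-- Uniqueness for linear equations with locally bounded coefficients. -/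
theorem eq_zero_of_norm_le (h : HasRightDeriv f f') (h0 : f 0 = 0)
    {T K : ℝ} (hK : ∀ t ∈ Ico 0 T, ‖f' t‖ ≤ K * ‖f t‖) : ∀ t ∈ Icc 0 T, f t = 0 := by
  intro t ht
  have := norm_le_gronwallBound_of_norm_deriv_right_le (f := f) (f' := f') (δ := 0) (K := K)
    (ε := 0) (a := 0) (b := T) (h.continuousOn_Icc T) (fun x hx => h.deriv x hx.1) (by simp [h0])
    (fun x hx => by simpa using hK x hx) t ht
  rw [gronwallBound_ε0_δ0] at this
  simpa using this

theorem eq_initial (h : HasRightDeriv f f') {T : ℝ} (h' : ∀ t ∈ Ico 0 T, f' t = 0) :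
    ∀ t ∈ Icc 0 T, f t = f 0 :=
  constant_of_has_deriv_right_zero (h.continuousOn_Icc T) fun t ht => h' t ht ▸ h.deriv t ht.1

end General

theorem nonneg_mono {f f' : ℝ → ℝ} (h : HasRightDeriv f f') {T : ℝ}
    (h' : ∀ t ∈ Ico 0 T, 0 ≤ f' t) : ∀ t ∈ Icc 0 T, f 0 ≤ f t :=
  fun _ ht => image_le_of_deriv_right_le_deriv_boundary (f := fun _ => f 0) (f' := fun _ => 0)
    continuousOn_const (fun x _ => hasDerivWithinAt_const x _ _) le_rfl (h.continuousOn_Icc T)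
    (fun x hx => h.deriv x hx.1) h' ht

/-- A function with nonnegative right derivative and equal end values has zero derivative. -/
theorem deriv_eq_zero {f f' : ℝ → ℝ} (h : HasRightDeriv f f') {T : ℝ}
    (h' : ∀ t ∈ Ico 0 T, 0 ≤ f' t) (hT : f T ≤ f 0) :
    ∀ t ∈ Ico 0 T, f' t = 0 := by
  have hc : ∀ t ∈ Icc 0 T, f t = f 0 := fun t ht => by
    refine le_antisymm ?_ (h.nonneg_mono h' t ht)
    have := (h.shift ht.1).nonneg_mono (T := T - t)
      (fun s hs => h' _ ⟨by linarith [hs.1, ht.1], by linarith [hs.2]⟩) (T - t)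
      ⟨by linarith [ht.2], le_rfl⟩
    simp only [zero_add, sub_add_cancel] at this
    linarith
  intro t ht
  have h1 := h.deriv t ht.1
  have h2 : HasDerivWithinAt f 0 (Ici t) t := by
    refine (hasDerivWithinAt_const t (Ici t) (f 0)).congr_of_eventuallyEq ?_
      (hc t ⟨ht.1, ht.2.le⟩)
    filter_upwards [Ico_mem_nhdsGE ht.2] with s hs
    exact hc s ⟨ht.1.trans hs.1, hs.2.le⟩
  exact (uniqueDiffWithinAt_Ici t).eq_deriv _ h1 h2

section Matrix

attribute [local instance] Matrix.linftyOpNormedRing Matrix.linftyOpNormedAlgebra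

variable {n : ℕ} {X X' Y Y' : ℝ → Matrix (Fin n) (Fin n) ℝ}

theorem mul (hX : HasRightDeriv X X') (hY : HasRightDeriv Y Y') :
    HasRightDeriv (fun t => X t * Y t) (fun t => X' t * Y t + X t * Y' t) :=
  ⟨hX.cont.mul hY.cont, fun t ht => (hX.deriv t ht).mul (hY.deriv t ht)⟩

theorem matrix_const (M : Matrix (Fin n) (Fin n) ℝ) : HasRightDeriv (fun _ => M) (fun _ => 0) :=
  ⟨continuousOn_const, fun t _ => hasDerivWithinAt_const t _ _⟩

theorem const_mul (hX : HasRightDeriv X X') (M : Matrix (Fin n) (Fin n) ℝ) :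
    HasRightDeriv (fun t => M * X t) (fun t => M * X' t) := by
  simpa using (matrix_const M).mul hX

theorem mul_const (hX : HasRightDeriv X X') (M : Matrix (Fin n) (Fin n) ℝ) :
    HasRightDeriv (fun t => X t * M) (fun t => X' t * M) := by
  simpa using hX.mul (matrix_const M)

theorem transpose (hX : HasRightDeriv X X') :
    HasRightDeriv (fun t => (X t)ᵀ) (fun t => (X' t)ᵀ) :=
  hX.clm (LinearMap.toContinuousLinearMap
    (Matrix.transposeLinearEquiv (Fin n) (Fin n) ℝ ℝ).toLinearMap)

theorem mulVec (hX : HasRightDeriv X X') (v : Fin n → ℝ) :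
    HasRightDeriv (fun t => X t *ᵥ v) (fun t => X' t *ᵥ v) :=
  hX.clm (LinearMap.toContinuousLinearMap ((Matrix.mulVecBilin ℝ ℝ).flip v))

theorem quad (hX : HasRightDeriv X X') (v : Fin n → ℝ) :
    HasRightDeriv (fun t => v ⬝ᵥ X t *ᵥ v) (fun t => v ⬝ᵥ X' t *ᵥ v) :=
  hX.clm (LinearMap.toContinuousLinearMap
    (dotProductBilin ℝ ℝ v ∘ₗ (Matrix.mulVecBilin ℝ ℝ).flip v))

theorem inv (hX : HasRightDeriv X X') (hu : ∀ t, 0 ≤ t → IsUnit (X t)) :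
    HasRightDeriv (fun t => (X t)⁻¹) (fun t => -((X t)⁻¹ * X' t * (X t)⁻¹)) := by
  have key : ∀ t, 0 ≤ t → HasFDerivAt (fun M : Matrix (Fin n) (Fin n) ℝ => M⁻¹)
      (-((ContinuousLinearMap.mulLeftRight ℝ (Matrix (Fin n) (Fin n) ℝ)) (X t)⁻¹) (X t)⁻¹)
      (X t) := by
    intro t ht
    obtain ⟨u, hu⟩ := hu t ht
    have e : (fun M : Matrix (Fin n) (Fin n) ℝ => M⁻¹) = Ring.inverse :=
      funext Matrix.nonsing_inv_eq_ringInverse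
    rw [← hu, ← Matrix.coe_units_inv, e]
    exact hasFDerivAt_ringInverse (𝕜 := ℝ) u
  refine ⟨fun t ht => ((key t ht).continuousAt.comp_continuousWithinAt (hX.cont t ht)),
    fun t ht => ?_⟩
  refine ((key t ht).comp_hasDerivWithinAt t (hX.deriv t ht)).congr_deriv ?_
  simp

/-- The matrix form of monotonicity. The order relations between Riccati solutions below come from a
conjugated quantity whose derivative is a sum of congruences of positive semidefinite matrices. -/
theorem posSemidef_sub (hX : HasRightDeriv X X') {T : ℝ}
    (h : ∀ t ∈ Ico 0 T, (X' t).PosSemidef) : ∀ t ∈ Icc 0 T, (X t - X 0).PosSemidef := by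
  intro t ht
  refine Matrix.PosSemidef.of_dotProduct_mulVec_nonneg ?_ fun v => ?_
  -- `PosSemidef` includes symmetry, and `X 0` need not be symmetric. The antisymmetric part of `X`
  -- has zero derivative, so it cancels in the difference.
  · have := (hX.transpose.sub hX).eq_initial (T := T)
      (fun s hs => by
        have := (h s hs).isHermitian.eq
        rw [Matrix.conjTranspose_eq_transpose_of_trivial] at this
        rw [this, sub_self]) t ht
    rw [Matrix.IsHermitian, Matrix.conjTranspose_eq_transpose_of_trivial, Matrix.transpose_sub]
    exact sub_eq_sub_iff_sub_eq_sub.mpr this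
  · have := (hX.quad v).nonneg_mono (T := T)
      (fun s hs => by simpa using (h s hs).dotProduct_mulVec_nonneg v) t ht
    simpa [Matrix.sub_mulVec, dotProduct_sub] using this

end Matrix

end HasRightDeriv
/-! ### Linear equations with piecewise constant coefficients -/

section Flow

variable {E : Type*} [NormedAddCommGroup E] [NormedSpace ℝ E]

/-- `f` solves `ẋ = F(t) x` on `[a, b]`. -/
structure SolvesOn (F : ℝ → E →L[ℝ] E) (a b : ℝ) (f : ℝ → E) : Prop where
  cont : ContinuousOn f (Icc a b)
  deriv : ∀ t ∈ Ico a b, HasDerivWithinAt f (F t (f t)) (Ici t) t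

/-- All initial value problems for `ẋ = F(t) x` at time `a` are solvable on `[a, b]`. -/
def HasFlow (F : ℝ → E →L[ℝ] E) (a b : ℝ) : Prop :=
  ∀ x : E, ∃ f : ℝ → E, f a = x ∧ SolvesOn F a b f

theorem HasFlow.of_const [CompleteSpace E] {F : ℝ → E →L[ℝ] E} {a b : ℝ} (L : E →L[ℝ] E)
    (h : ∀ t ∈ Ico a b, F t = L) : HasFlow F a b := by
  intro x
  have key : ∀ t, HasDerivAt (fun t : ℝ => NormedSpace.exp ((t - a) • L) x)
      (L (NormedSpace.exp ((t - a) • L) x)) t := by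
    intro t
    have h1 := (hasDerivAt_exp_smul_const' (𝕂 := ℝ) L (t - a)).scomp t
      ((hasDerivAt_id t).sub_const a)
    simpa [Function.comp_def] using h1.clm_apply (hasDerivAt_const t x)
  refine ⟨fun t => NormedSpace.exp ((t - a) • L) x, by simp,
    fun t _ => (key t).continuousAt.continuousWithinAt, fun t ht => ?_⟩
  rw [h t ht]
  exact (key t).hasDerivWithinAt

theorem HasFlow.trans {F : ℝ → E →L[ℝ] E} {a b c : ℝ} (hab : a ≤ b) (hbc : b ≤ c)
    (h₁ : HasFlow F a b) (h₂ : HasFlow F b c) : HasFlow F a c := by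
  intro x
  obtain ⟨f, hfx, hf⟩ := h₁ x
  obtain ⟨g, hgx, hg⟩ := h₂ (f b)
  have e1 : ∀ t, t ≤ b → (if t ≤ b then f t else g t) = f t := fun t ht => if_pos ht
  have e2 : ∀ t, b ≤ t → (if t ≤ b then f t else g t) = g t := fun t ht => by
    split_ifs with h
    · rw [le_antisymm h ht, hgx]
    · rfl
  refine ⟨fun t => if t ≤ b then f t else g t, by simp [hab, hfx], ?_, fun t ht => ?_⟩
  · rw [← Icc_union_Icc_eq_Icc hab hbc]
    exact (hf.cont.congr fun t ht => e1 t ht.2).union_of_isClosed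
      (hg.cont.congr fun t ht => e2 t ht.1) isClosed_Icc isClosed_Icc
  · rcases lt_or_ge t b with htb | htb
    · simp only [e1 t htb.le]
      refine (hf.deriv t ⟨ht.1, htb⟩).congr_of_eventuallyEq ?_ (e1 t htb.le)
      filter_upwards [Ico_mem_nhdsGE htb] with s hs using e1 s hs.2.le
    · simp only [e2 t htb]
      exact (hg.deriv t ⟨htb, ht.2⟩).congr (fun s hs => e2 s (htb.trans hs)) (e2 t htb)

theorem SolvesOn.shift {F : ℝ → E →L[ℝ] E} {a b : ℝ} {f : ℝ → E} (h : SolvesOn F a b f) (c : ℝ)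
    (hF : ∀ t, F (t - c) = F t) : SolvesOn F (a + c) (b + c) (fun t => f (t - c)) := by
  refine ⟨h.cont.comp (by fun_prop) fun t ht => ?_, fun t ht => ?_⟩
  · simp only [mem_Icc] at *; constructor <;> linarith
  · have h1 := h.deriv (t - c) (by simp only [mem_Ico] at *; constructor <;> linarith)
    rw [hF] at h1
    simp only [sub_eq_add_neg] at h1 ⊢
    exact hasDerivWithinAt_Ici_comp_add h1

theorem HasFlow.shift {F : ℝ → E →L[ℝ] E} {a b : ℝ} (h : HasFlow F a b) (c : ℝ)
    (hF : ∀ t, F (t - c) = F t) : HasFlow F (a + c) (b + c) := fun x => by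
  obtain ⟨f, hfx, hf⟩ := h x
  exact ⟨fun t => f (t - c), by simp [hfx], hf.shift c hF⟩

theorem HasFlow.nat_mul {F : ℝ → E →L[ℝ] E} {ε : ℝ} (hε : 0 < ε) (hF : Function.Periodic F ε)
    (h : HasFlow F 0 ε) (k : ℕ) : HasFlow F 0 (k * ε) := by
  induction k with
  | zero =>
    intro x
    refine ⟨fun _ => x, rfl, continuousOn_const, fun t ht => ?_⟩
    simp only [Nat.cast_zero, zero_mul, Ico_self] at ht
    exact ht.elim
  | succ k ih =>
    have h2 := h.shift (k * ε) fun t => by simpa using hF.sub_nat_mul_eq (x := t) k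
    rw [zero_add] at h2
    convert ih.trans (by positivity) (by linarith) h2 using 1
    push_cast; ring

theorem SolvesOn.eqOn {F : ℝ → E →L[ℝ] E} {a b K : ℝ} {f g : ℝ → E} (hK : ∀ t, ‖F t‖ ≤ K)
    (hf : SolvesOn F a b f) (hg : SolvesOn F a b g) (h : f a = g a) :
    ∀ t ∈ Icc a b, f t = g t := by
  intro t ht
  have := norm_le_gronwallBound_of_norm_deriv_right_le (f := fun t => f t - g t)
    (f' := fun t => F t (f t) - F t (g t)) (δ := 0) (K := K)
    (ε := 0) (hf.cont.sub hg.cont) (fun x hx => (hf.deriv x hx).sub (hg.deriv x hx)) (by simp [h])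
    (fun x _ => by
      rw [← map_sub, add_zero]
      exact (F x).le_of_opNorm_le (hK x) _) t ht
  rw [gronwallBound_ε0_δ0] at this
  simpa [sub_eq_zero] using this

theorem SolvesOn.mono {F : ℝ → E →L[ℝ] E} {a b c : ℝ} {f : ℝ → E} (h : SolvesOn F a c f)
    (hb : b ≤ c) : SolvesOn F a b f :=
  ⟨h.cont.mono (Icc_subset_Icc_right hb), fun t ht => h.deriv t ⟨ht.1, ht.2.trans_le hb⟩⟩

/-- Solutions of periodic linear equations extend from one period to the half-line. -/
theorem HasFlow.exists_hasRightDeriv {F : ℝ → E →L[ℝ] E} {ε K : ℝ} (hε : 0 < ε)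
    (hF : Function.Periodic F ε) (hK : ∀ t, ‖F t‖ ≤ K) (h : HasFlow F 0 ε) (x : E) :
    ∃ f : ℝ → E, f 0 = x ∧ HasRightDeriv f (fun t => F t (f t)) := by
  choose f hfx hf using fun k => h.nat_mul hε hF k x
  have hmono : ∀ {k l : ℕ}, k ≤ l → (k : ℝ) * ε ≤ l * ε := fun hkl => by gcongr
  have heq : ∀ {k l : ℕ}, k ≤ l → ∀ t ∈ Icc 0 (k * ε), f k t = f l t := fun {k l} hkl =>
    (hf k).eqOn hK ((hf l).mono (hmono hkl)) ((hfx k).trans (hfx l).symm)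
  -- The value at `t` is read off from a solution over enough periods to reach `t`; by `heq` the
  -- number of periods does not matter.
  let m : ℝ → ℕ := fun t => ⌈t / ε⌉₊
  have hm : ∀ t, t ≤ m t * ε := fun t => (div_le_iff₀ hε).mp (Nat.le_ceil _)
  have key : ∀ (k : ℕ) (t : ℝ), t ∈ Icc 0 (k * ε) → f (m t) t = f k t := fun k t ht => by
    refine heq (Nat.ceil_le.mpr ((div_le_iff₀ hε).mpr ht.2)) t ⟨ht.1, hm t⟩
  refine ⟨fun t => f (m t) t, (key 0 0 (by simp)).trans (hfx 0), fun t ht => ?_, fun t ht => ?_⟩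
  -- One period more than `m t`, so that the chosen interval extends strictly to the right of `t`.
  · have hlt : t < ((m t + 1 : ℕ) : ℝ) * ε := by push_cast; linarith [hm t]
    have h1 := (hf (m t + 1)).cont.congr (key _) t ⟨ht, hlt.le⟩
    refine h1.mono_of_mem_nhdsWithin ?_
    rw [← Ici_inter_Iic]
    exact inter_mem self_mem_nhdsWithin (mem_nhdsWithin_of_mem_nhds (Iic_mem_nhds hlt))
  · have hlt : t < ((m t + 1 : ℕ) : ℝ) * ε := by push_cast; linarith [hm t]
    have h1 := (hf (m t + 1)).deriv t ⟨ht, hlt⟩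
    have e := key (m t + 1) t ⟨ht, hlt.le⟩
    simp only [e]
    refine h1.congr_of_eventuallyEq ?_ e
    filter_upwards [Ico_mem_nhdsGE hlt] with s hs using key _ s ⟨ht.trans hs.1, hs.2.le⟩

end Flow

/-! ### Consequences of controllability -/

section Controllability

variable {n : ℕ} {A W : Matrix (Fin n) (Fin n) ℝ}

theorem sqrt_isSymm (W : Matrix (Fin n) (Fin n) ℝ) : (CFC.sqrt W)ᵀ = CFC.sqrt W := by
  have := (Matrix.nonneg_iff_posSemidef.mp (CFC.sqrt_nonneg W)).isHermitian.eq
  rwa [Matrix.conjTranspose_eq_transpose_of_trivial] at this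

theorem sqrt_mul_self (hW : W.PosSemidef) : CFC.sqrt W * CFC.sqrt W = W :=
  CFC.sqrt_mul_sqrt_self W hW.nonneg

theorem sqrt_mulVec_eq_zero (hW : W.PosSemidef) {z : Fin n → ℝ} (hz : W *ᵥ z = 0) :
    CFC.sqrt W *ᵥ z = 0 := by
  have h : (CFC.sqrt W *ᵥ z) ⬝ᵥ (CFC.sqrt W *ᵥ z) = 0 := by
    rw [Matrix.dotProduct_mulVec, Matrix.vecMul_mulVec, sqrt_isSymm W, sqrt_mul_self hW,
      ← Matrix.dotProduct_mulVec, hz, dotProduct_zero]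
  exact dotProduct_self_eq_zero.mp h

/-- The dual form of the Kalman rank condition: `y` is orthogonal to all generators `A ^ k √W w`,
hence to itself. -/
theorem eq_zero_of_forall_mulVec_pow (hW : W.PosSemidef) (hc : IsControllable A (CFC.sqrt W))
    {y : Fin n → ℝ} (hy : ∀ k, W *ᵥ ((Aᵀ) ^ k *ᵥ y) = 0) : y = 0 := by
  have hmem : y ∈ Submodule.span ℝ {v : Fin n → ℝ | ∃ k < n, ∃ w : Fin n → ℝ,
      v = (A ^ k * CFC.sqrt W) *ᵥ w} := by
    rw [IsControllable] at hc
    rw [hc]; trivial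
  suffices h : ∀ v ∈ Submodule.span ℝ {v : Fin n → ℝ | ∃ k < n, ∃ w : Fin n → ℝ,
      v = (A ^ k * CFC.sqrt W) *ᵥ w}, y ⬝ᵥ v = 0 from dotProduct_self_eq_zero.mp (h y hmem)
  intro v hv
  induction hv using Submodule.span_induction with
  | mem v hv =>
    obtain ⟨k, -, w, rfl⟩ := hv
    have := sqrt_mulVec_eq_zero hW (hy k)
    rw [Matrix.dotProduct_mulVec, ← Matrix.mulVec_transpose, Matrix.transpose_mul,
      sqrt_isSymm W, Matrix.transpose_pow, ← Matrix.mulVec_mulVec, this, zero_dotProduct]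
  | zero => simp
  | add a b _ _ ha hb => rw [dotProduct_add, ha, hb, add_zero]
  | smul c a _ ha => rw [dotProduct_smul, ha, smul_zero]

/-- A solution of the adjoint equation which is not excited through `W` on an interval
vanishes. -/
theorem eq_zero_of_adjoint (hW : W.PosSemidef) (hc : IsControllable A (CFC.sqrt W))
    {y y' : ℝ → Fin n → ℝ} (hy : HasRightDeriv y y') {T : ℝ} (hT : 0 < T)
    (h1 : ∀ t ∈ Ico 0 T, y' t = -(Aᵀ *ᵥ y t)) (h2 : ∀ t ∈ Ico 0 T, W *ᵥ y t = 0) : y 0 = 0 := by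
  refine eq_zero_of_forall_mulVec_pow hW hc fun k => ?_
  suffices h : ∀ k, ∀ t ∈ Ico 0 T, W *ᵥ ((Aᵀ) ^ k *ᵥ y t) = 0 from h k 0 ⟨le_rfl, hT⟩
  intro k
  induction k with
  | zero => simpa using h2
  | succ k ih =>
    intro t ht
    -- Differentiating the identity for `k` along the adjoint equation gives the identity for `k +
    -- 1`.
    have hd := (hy.clm (LinearMap.toContinuousLinearMap
      (Matrix.mulVecLin (W * (Aᵀ) ^ k)))).deriv t ht.1
    simp only [LinearMap.coe_toContinuousLinearMap', Matrix.mulVecLin_apply] at hd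
    have h0 : HasDerivWithinAt (fun t => (W * (Aᵀ) ^ k) *ᵥ y t) 0 (Ici t) t := by
      have e : ∀ s ∈ Ico 0 T, (W * (Aᵀ) ^ k) *ᵥ y s = 0 := fun s hs => by
        rw [← Matrix.mulVec_mulVec]; exact ih s hs
      refine (hasDerivWithinAt_const t (Ici t) 0).congr_of_eventuallyEq ?_ (e t ht)
      filter_upwards [Ico_mem_nhdsGE ht.2] with s hs using e s ⟨ht.1.trans hs.1, hs.2⟩
    have := (uniqueDiffWithinAt_Ici t).eq_deriv _ hd h0
    rw [h1 t ht, Matrix.mulVec_neg, neg_eq_zero] at this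
    rw [pow_succ]
    simpa [Matrix.mulVec_mulVec, mul_assoc] using this

end Controllability

/-! ### Periodic switching coefficients -/

/-- A piecewise constant, right-continuous, `τ`-periodic function with finitely many values, all of
them positive semidefinite. -/
structure IsSwitching {n : ℕ} (τ : ℝ) (G : ℝ → Matrix (Fin n) (Fin n) ℝ) : Prop where
  pos : 0 < τ
  periodic : Function.Periodic G τ
  posSemidef : ∀ t, (G t).PosSemidef
  finite_range : (range G).Finite
  piecewise : ∃ (m : ℕ) (s : ℕ → ℝ), s 0 = 0 ∧ s m = τ ∧ (∀ k, s k ≤ s (k + 1)) ∧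
    ∀ k < m, ∃ H, ∀ t ∈ Ico (s k) (s (k + 1)), G t = H

section Matrix

attribute [local instance] Matrix.linftyOpNormedRing Matrix.linftyOpNormedAlgebra

variable {n : ℕ} {A W : Matrix (Fin n) (Fin n) ℝ}

theorem hasDerivAt_exp (B : Matrix (Fin n) (Fin n) ℝ) (t : ℝ) :
    HasDerivAt (fun t : ℝ => NormedSpace.exp (t • B)) (NormedSpace.exp (t • B) * B) t :=
  hasDerivAt_exp_smul_const B t

theorem hasRightDeriv_exp (B : Matrix (Fin n) (Fin n) ℝ) :
    HasRightDeriv (fun t : ℝ => NormedSpace.exp (t • B))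
      (fun t => NormedSpace.exp (t • B) * B) :=
  ⟨fun t _ => (hasDerivAt_exp B t).continuousAt.continuousWithinAt,
    fun t _ => (hasDerivAt_exp B t).hasDerivWithinAt⟩

theorem hasRightDeriv_exp' (B : Matrix (Fin n) (Fin n) ℝ) :
    HasRightDeriv (fun t : ℝ => NormedSpace.exp (t • B))
      (fun t => B * NormedSpace.exp (t • B)) :=
  (hasRightDeriv_exp B).congr_deriv fun t _ =>
    (((Commute.refl B).smul_left t).exp_left.eq)

theorem exp_mul_exp_neg (B : Matrix (Fin n) (Fin n) ℝ) :
    NormedSpace.exp B * NormedSpace.exp (-B) = 1 := by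
  rw [← Matrix.exp_add_of_commute _ _ (Commute.refl B).neg_right, add_neg_cancel,
    NormedSpace.exp_zero]

/-- The Hamiltonian vector field `(U, V) ↦ (-Aᵀ U + G V, W U + A V)`. -/
def hamiltonian (A W G : Matrix (Fin n) (Fin n) ℝ) :
    (Matrix (Fin n) (Fin n) ℝ × Matrix (Fin n) (Fin n) ℝ) →ₗ[ℝ]
      (Matrix (Fin n) (Fin n) ℝ × Matrix (Fin n) (Fin n) ℝ) where
  toFun p := (-(Aᵀ * p.1) + G * p.2, W * p.1 + A * p.2)
  map_add' p q := by ext1 <;> simp [mul_add] <;> abel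
  map_smul' c p := by ext1 <;> simp

theorem IsSwitching.hasFlow {E : Type*} [NormedAddCommGroup E] [NormedSpace ℝ E] [CompleteSpace E]
    {τ : ℝ} {G : ℝ → Matrix (Fin n) (Fin n) ℝ} (hG : IsSwitching τ G)
    (Φ : Matrix (Fin n) (Fin n) ℝ → E →L[ℝ] E) : HasFlow (fun t => Φ (G t)) 0 τ := by
  obtain ⟨m, s, h0, hm, hs, hH⟩ := hG.piecewise
  have hmono : Monotone s := monotone_nat_of_le_succ hs
  suffices h : ∀ k ≤ m, HasFlow (fun t => Φ (G t)) 0 (s k) from hm ▸ h m le_rfl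
  intro k hk
  induction k with
  | zero =>
    rw [h0]
    exact HasFlow.of_const 0 fun t ht => by simp at ht
  | succ k ih =>
    obtain ⟨H, hH⟩ := hH k hk
    exact (ih (by lia)).trans (h0 ▸ hmono k.zero_le) (hs k)
      (HasFlow.of_const (Φ H) fun t ht => by rw [hH t ht])

theorem IsSwitching.exists_bound {τ : ℝ} {G : ℝ → Matrix (Fin n) (Fin n) ℝ}
    (hG : IsSwitching τ G) (ν : Matrix (Fin n) (Fin n) ℝ → ℝ) : ∃ K, ∀ t, ν (G t) ≤ K := by
  obtain ⟨K, hK⟩ := (hG.finite_range.image ν).bddAbove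
  exact ⟨K, fun t => hK ⟨G t, ⟨t, rfl⟩, rfl⟩⟩

theorem IsSwitching.exists_solution {E : Type*} [NormedAddCommGroup E] [NormedSpace ℝ E]
    [FiniteDimensional ℝ E] {τ : ℝ} {G : ℝ → Matrix (Fin n) (Fin n) ℝ} (hG : IsSwitching τ G)
    (L : Matrix (Fin n) (Fin n) ℝ → E →ₗ[ℝ] E) (x : E) :
    ∃ f : ℝ → E, f 0 = x ∧ HasRightDeriv f (fun t => L (G t) (f t)) := by
  have : CompleteSpace E := FiniteDimensional.complete ℝ E
  obtain ⟨K, hK⟩ := hG.exists_bound fun H => ‖LinearMap.toContinuousLinearMap (L H)‖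
  exact HasFlow.exists_hasRightDeriv hG.pos
    (F := fun t => LinearMap.toContinuousLinearMap (L (G t)))
    (fun t => by simp only [hG.periodic t]) hK
    (hG.hasFlow fun H => LinearMap.toContinuousLinearMap (L H)) x

theorem IsSwitching.exists_hamiltonian_flow {τ : ℝ} {G : ℝ → Matrix (Fin n) (Fin n) ℝ}
    (hG : IsSwitching τ G) (A W U₀ V₀ : Matrix (Fin n) (Fin n) ℝ) :
    ∃ U V : ℝ → Matrix (Fin n) (Fin n) ℝ, U 0 = U₀ ∧ V 0 = V₀ ∧
      HasRightDeriv U (fun t => -(Aᵀ * U t) + G t * V t) ∧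
      HasRightDeriv V (fun t => W * U t + A * V t) := by
  obtain ⟨f, hf0, hf⟩ := hG.exists_solution (hamiltonian A W) (U₀, V₀)
  exact ⟨fun t => (f t).1, fun t => (f t).2, by simp [hf0], by simp [hf0],
    hf.clm (ContinuousLinearMap.fst ℝ _ _), hf.clm (ContinuousLinearMap.snd ℝ _ _)⟩

end Matrix

/-! ### The Riccati equation on the half-line -/

section Matrix

attribute [local instance] Matrix.linftyOpNormedRing Matrix.linftyOpNormedAlgebra

variable {n : ℕ} {A W : Matrix (Fin n) (Fin n) ℝ} {τ : ℝ}
  {G X Y U UY : ℝ → Matrix (Fin n) (Fin n) ℝ}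

theorem _root_.Matrix.PosSemidef.transpose_eq {M : Matrix (Fin n) (Fin n) ℝ}
    (h : M.PosSemidef) : Mᵀ = M := by
  have := h.isHermitian.eq
  rwa [Matrix.conjTranspose_eq_transpose_of_trivial] at this

theorem _root_.Matrix.PosSemidef.transpose_mul_mul {M : Matrix (Fin n) (Fin n) ℝ}
    (h : M.PosSemidef) (B : Matrix (Fin n) (Fin n) ℝ) : (Bᵀ * M * B).PosSemidef := by
  have := h.conjTranspose_mul_mul_same B
  rwa [Matrix.conjTranspose_eq_transpose_of_trivial] at this

theorem posSemidef_of_transpose_mul_mul {M B : Matrix (Fin n) (Fin n) ℝ} (hB : IsUnit B)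
    (h : (Bᵀ * M * B).PosSemidef) : M.PosSemidef := by
  have h1 := h.transpose_mul_mul B⁻¹
  have h2 : B * B⁻¹ = 1 := Matrix.mul_nonsing_inv _ ((Matrix.isUnit_iff_isUnit_det _).mp hB)
  have h3 : (B⁻¹)ᵀ * Bᵀ = 1 := by rw [← Matrix.transpose_mul, h2, Matrix.transpose_one]
  convert h1 using 1
  calc M = ((B⁻¹)ᵀ * Bᵀ) * M * (B * B⁻¹) := by rw [h2, h3, one_mul, mul_one]
    _ = _ := by noncomm_ring

theorem dotProduct_conj (M B : Matrix (Fin n) (Fin n) ℝ) (x : Fin n → ℝ) :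
    x ⬝ᵥ (Bᵀ * M * B) *ᵥ x = (B *ᵥ x) ⬝ᵥ M *ᵥ (B *ᵥ x) := by
  rw [← Matrix.mulVec_mulVec, ← Matrix.mulVec_mulVec, Matrix.dotProduct_mulVec x,
    Matrix.vecMul_transpose]

theorem _root_.Matrix.PosSemidef.quad_nonneg {M : Matrix (Fin n) (Fin n) ℝ}
    (h : M.PosSemidef) (x : Fin n → ℝ) : 0 ≤ x ⬝ᵥ M *ᵥ x := by
  simpa using h.dotProduct_mulVec_nonneg x

theorem _root_.Matrix.PosSemidef.mulVec_eq_zero {M : Matrix (Fin n) (Fin n) ℝ}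
    (h : M.PosSemidef) {x : Fin n → ℝ} (hx : x ⬝ᵥ M *ᵥ x = 0) : M *ᵥ x = 0 :=
  (h.dotProduct_mulVec_zero_iff x).mp (by simpa using hx)

/-- A solution `X` of the Riccati equation on `[0, ∞)` together with the fundamental matrix `U` of
the adjoint `u̇ = (-Aᵀ + G X) u` of the closed loop. -/
structure ClosedLoop (A W : Matrix (Fin n) (Fin n) ℝ)
    (G X U : ℝ → Matrix (Fin n) (Fin n) ℝ) : Prop where
  riccati : HasRightDeriv X (fun t => riccati A W (G t) (X t))
  initial : U 0 = 1
  adjoint : HasRightDeriv U (fun t => (-Aᵀ + G t * X t) * U t)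
  isUnit : ∀ t, 0 ≤ t → IsUnit (U t)

/-- The solution is `V U⁻¹` for the linear Hamiltonian flow, so the only obstruction to global
existence is a singular `U`. Positive semidefiniteness of `X₀`, `W` and `G` excludes it. -/
theorem IsSwitching.exists_closedLoop (hG : IsSwitching τ G) (hW : W.PosSemidef)
    {X₀ : Matrix (Fin n) (Fin n) ℝ} (hX₀ : X₀.PosSemidef) :
    ∃ X U : ℝ → Matrix (Fin n) (Fin n) ℝ, X 0 = X₀ ∧ ClosedLoop A W G X U := by
  obtain ⟨U, V, hU0, hV0, hU, hV⟩ := hG.exists_hamiltonian_flow A W 1 X₀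
  have hunit : ∀ T, 0 ≤ T → IsUnit (U T) := by
    intro T hT
    rw [Matrix.isUnit_iff_isUnit_det, isUnit_iff_ne_zero]
    intro hdet
    obtain ⟨x, hx0, hx⟩ := Matrix.exists_mulVec_eq_zero_iff.mpr hdet
    -- For `U T x = 0`, the form `x ⬝ Uᵀ V x` is nondecreasing, starts at `x ⬝ X₀ x ≥ 0` and ends at
    -- `0`. It is therefore constant and `G V x` vanishes.
    have hq := (hU.transpose.mul hV).quad x
    have hd : ∀ t, x ⬝ᵥ ((-(Aᵀ * U t) + G t * V t)ᵀ * V t + (U t)ᵀ * (W * U t + A * V t)) *ᵥ x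
        = (V t *ᵥ x) ⬝ᵥ G t *ᵥ (V t *ᵥ x) + (U t *ᵥ x) ⬝ᵥ W *ᵥ (U t *ᵥ x) := fun t => by
      rw [← dotProduct_conj, ← dotProduct_conj, ← dotProduct_add, ← Matrix.add_mulVec]
      congr 2
      simp only [Matrix.transpose_add, Matrix.transpose_neg, Matrix.transpose_mul,
        Matrix.transpose_transpose, (hG.posSemidef t).transpose_eq]
      noncomm_ring
    have hz := hq.deriv_eq_zero (T := T) (fun t _ => by
      rw [hd]
      exact add_nonneg ((hG.posSemidef t).quad_nonneg _) (hW.quad_nonneg _)) (by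
        rw [← Matrix.mulVec_mulVec, Matrix.dotProduct_mulVec, Matrix.vecMul_transpose, hx, hU0, hV0]
        simpa using hX₀.quad_nonneg x)
    have hGV : ∀ t ∈ Ico 0 T, G t *ᵥ (V t *ᵥ x) = 0 := fun t ht => by
      have h1 := hz t ht
      rw [hd] at h1
      have h2 := (hG.posSemidef t).quad_nonneg (V t *ᵥ x)
      have h3 := hW.quad_nonneg (U t *ᵥ x)
      exact (hG.posSemidef t).mulVec_eq_zero (by linarith)
    -- Without the term `G V x`, the vector `U x` obeys `u̇ = -Aᵀ u`, and `exp(tAᵀ) U x` keeps its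
    -- initial value `x`; at `T` it is zero.
    have hc := (((hasRightDeriv_exp Aᵀ).mul hU).mulVec x).eq_initial (T := T) (fun t ht => by
      have e : NormedSpace.exp (t • Aᵀ) * Aᵀ * U t
          + NormedSpace.exp (t • Aᵀ) * (-(Aᵀ * U t) + G t * V t)
          = NormedSpace.exp (t • Aᵀ) * (G t * V t) := by noncomm_ring
      rw [e, ← Matrix.mulVec_mulVec, ← Matrix.mulVec_mulVec, hGV t ht, Matrix.mulVec_zero]) T
      ⟨hT, le_rfl⟩
    rw [← Matrix.mulVec_mulVec, hx] at hc
    simp only [Matrix.mulVec_zero, zero_smul, NormedSpace.exp_zero, hU0, mul_one,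
      Matrix.one_mulVec] at hc
    exact hx0 hc.symm
  have hVU : ∀ t, 0 ≤ t → V t * (U t)⁻¹ * U t = V t := fun t ht =>
    Matrix.nonsing_inv_mul_cancel_right _ _ ((Matrix.isUnit_iff_isUnit_det _).mp (hunit t ht))
  refine ⟨fun t => V t * (U t)⁻¹, U, by simp [hU0, hV0], ?_, hU0, ?_, hunit⟩
  · refine (hV.mul (hU.inv hunit)).congr_deriv fun t ht => ?_
    have h1 : U t * (U t)⁻¹ = 1 :=
      Matrix.mul_nonsing_inv _ ((Matrix.isUnit_iff_isUnit_det _).mp (hunit t ht))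
    have e : (W * U t + A * V t) * (U t)⁻¹
        + V t * -((U t)⁻¹ * (-(Aᵀ * U t) + G t * V t) * (U t)⁻¹)
        = W * (U t * (U t)⁻¹) + A * (V t * (U t)⁻¹) + V t * (U t)⁻¹ * Aᵀ * (U t * (U t)⁻¹)
          - V t * (U t)⁻¹ * G t * (V t * (U t)⁻¹) := by noncomm_ring
    rw [e, h1, SensorScheduling.riccati]
    noncomm_ring
  · refine hU.congr_deriv fun t ht => ?_
    rw [add_mul, mul_assoc (G t), hVU t ht, neg_mul]

theorem exists_norm_le_of_continuousOn (h : ContinuousOn X (Ici 0)) (T : ℝ) :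
    ∃ K, ∀ t ∈ Icc 0 T, ‖X t‖ ≤ K :=
  isCompact_Icc.exists_bound_of_continuousOn (h.mono Icc_subset_Ici_self)

theorem norm_linear_le {a b : ℝ} {L R D : Matrix (Fin n) (Fin n) ℝ} (hL : ‖L‖ ≤ a)
    (hR : ‖R‖ ≤ b) : ‖L * D + D * R‖ ≤ (a + b) * ‖D‖ := by
  have h0 := norm_nonneg D
  calc ‖L * D + D * R‖ ≤ ‖L‖ * ‖D‖ + ‖D‖ * ‖R‖ :=
        (norm_add_le _ _).trans (add_le_add (norm_mul_le _ _) (norm_mul_le _ _))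
    _ ≤ a * ‖D‖ + ‖D‖ * b := by gcongr
    _ = _ := by ring

/-- With both solutions known, the difference obeys a linear equation whose coefficients are bounded
on compact intervals. Uniqueness then follows from Gronwall. -/
theorem riccati_sub (A W G X Y : Matrix (Fin n) (Fin n) ℝ) :
    riccati A W G X - riccati A W G Y = (A - X * G) * (X - Y) + (X - Y) * (Aᵀ - G * Y) := by
  rw [riccati, riccati]
  noncomm_ring

theorem IsSwitching.riccati_unique (hG : IsSwitching τ G)
    (hX : HasRightDeriv X (fun t => riccati A W (G t) (X t)))
    (hY : HasRightDeriv Y (fun t => riccati A W (G t) (Y t))) (h0 : X 0 = Y 0) :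
    ∀ t, 0 ≤ t → X t = Y t := by
  intro T hT
  obtain ⟨a, ha⟩ := exists_norm_le_of_continuousOn hX.cont T
  obtain ⟨b, hb⟩ := exists_norm_le_of_continuousOn hY.cont T
  obtain ⟨c, hc⟩ := hG.exists_bound (‖·‖)
  have := (hX.sub hY).eq_zero_of_norm_le (by simp [h0]) (T := T)
    (K := (‖A‖ + a * c) + (‖Aᵀ‖ + c * b)) (fun t ht => by
      have ht' := Ico_subset_Icc_self ht
      have hc0 := (norm_nonneg _).trans (hc t)
      have ha0 := (norm_nonneg _).trans (ha t ht')
      rw [riccati_sub]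
      refine norm_linear_le ((norm_sub_le _ _).trans ?_) ((norm_sub_le _ _).trans ?_)
      · gcongr
        exact (norm_mul_le _ _).trans (mul_le_mul (ha t ht') (hc t) (norm_nonneg _) ha0)
      · gcongr
        exact (norm_mul_le _ _).trans (mul_le_mul (hc t) (hb t ht') (norm_nonneg _) hc0))
    T ⟨hT, le_rfl⟩
  exact sub_eq_zero.mp this

theorem IsSwitching.exists_adjoint (hG : IsSwitching τ G) (hW : W.PosSemidef)
    (hX : HasRightDeriv X (fun t => SensorScheduling.riccati A W (G t) (X t)))
    (h0 : (X 0).PosSemidef) : ∃ U, ClosedLoop A W G X U := by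
  obtain ⟨Y, U, hY0, h⟩ := hG.exists_closedLoop (A := A) hW h0
  have e := hG.riccati_unique hX h.riccati hY0.symm
  exact ⟨U, hX, h.initial, h.adjoint.congr_deriv fun t ht => by rw [e t ht], h.isUnit⟩

/-! ### Conjugation identities and comparison of Riccati solutions. -/

namespace ClosedLoop

/-- Conjugation by the adjoint flow cancels the terms in `A` and leaves only the two nonnegative
sources, process noise and information. -/
theorem hasRightDeriv_conj (h : ClosedLoop A W G X U) (hG : IsSwitching τ G) :
    HasRightDeriv (fun t => (U t)ᵀ * X t * U t)
      (fun t => (U t)ᵀ * W * U t + (X t * U t)ᵀ * G t * (X t * U t)) := by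
  refine ((h.adjoint.transpose.mul h.riccati).mul h.adjoint).congr_deriv fun t _ => ?_
  simp only [Matrix.transpose_add, Matrix.transpose_neg, Matrix.transpose_mul,
    Matrix.transpose_transpose, (hG.posSemidef t).transpose_eq, SensorScheduling.riccati]
  noncomm_ring

theorem posSemidef_conj_deriv (hG : IsSwitching τ G) (hW : W.PosSemidef) (t : ℝ) :
    ((U t)ᵀ * W * U t + (X t * U t)ᵀ * G t * (X t * U t)).PosSemidef :=
  (hW.transpose_mul_mul _).add ((hG.posSemidef t).transpose_mul_mul _)

theorem posSemidef_conj_sub (h : ClosedLoop A W G X U) (hG : IsSwitching τ G)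
    (hW : W.PosSemidef) {t : ℝ} (ht : 0 ≤ t) :
    ((U t)ᵀ * X t * U t - X 0).PosSemidef := by
  simpa [h.initial] using (h.hasRightDeriv_conj hG).posSemidef_sub (T := t)
    (fun s _ => posSemidef_conj_deriv hG hW s) t ⟨ht, le_rfl⟩

theorem posSemidef (h : ClosedLoop A W G X U) (hG : IsSwitching τ G)
    (hW : W.PosSemidef) (h0 : (X 0).PosSemidef) {t : ℝ} (ht : 0 ≤ t) : (X t).PosSemidef :=
  posSemidef_of_transpose_mul_mul (h.isUnit t ht)
    (by simpa using (h.posSemidef_conj_sub hG hW ht).add h0)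

/-- Equality would make the derivative of the conjugated form vanish on `[0, T)`. Then `U x` solves
the free adjoint equation unexcited through `W`, which controllability forbids for `x ≠ 0`. -/
theorem lt_conj (h : ClosedLoop A W G X U) (hG : IsSwitching τ G) (hW : W.PosSemidef)
    (hc : IsControllable A (CFC.sqrt W)) {T : ℝ} (hT : 0 < T) {x : Fin n → ℝ} (hx : x ≠ 0) :
    x ⬝ᵥ X 0 *ᵥ x < (U T *ᵥ x) ⬝ᵥ X T *ᵥ (U T *ᵥ x) := by
  by_contra! hle
  rw [← dotProduct_conj] at hle
  have hz := ((h.hasRightDeriv_conj hG).quad x).deriv_eq_zero (T := T)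
    (fun t _ => (posSemidef_conj_deriv hG hW t).quad_nonneg x) (by simpa [h.initial] using hle)
  have key : ∀ t ∈ Ico 0 T, W *ᵥ (U t *ᵥ x) = 0 ∧ G t *ᵥ ((X t * U t) *ᵥ x) = 0 := fun t ht => by
    have h1 := hz t ht
    rw [Matrix.add_mulVec, dotProduct_add, dotProduct_conj, dotProduct_conj] at h1
    have h2 := (hG.posSemidef t).quad_nonneg ((X t * U t) *ᵥ x)
    have h3 := hW.quad_nonneg (U t *ᵥ x)
    exact ⟨hW.mulVec_eq_zero (by linarith), (hG.posSemidef t).mulVec_eq_zero (by linarith)⟩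
  have := eq_zero_of_adjoint hW hc (h.adjoint.mulVec x) hT (fun t ht => by
    rw [add_mul, Matrix.add_mulVec, mul_assoc, ← Matrix.mulVec_mulVec _ (G t), (key t ht).2,
      add_zero, neg_mul, Matrix.neg_mulVec, Matrix.mulVec_mulVec]) fun t ht => (key t ht).1
  rw [h.initial, Matrix.one_mulVec] at this
  exact hx this

theorem posDef (h : ClosedLoop A W G X U) (hG : IsSwitching τ G) (hW : W.PosSemidef)
    (hc : IsControllable A (CFC.sqrt W)) (h0 : (X 0).PosSemidef) {T : ℝ} (hT : 0 < T) :
    (X T).PosDef := by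
  refine Matrix.PosDef.of_dotProduct_mulVec_pos (h.posSemidef hG hW h0 hT.le).isHermitian
    fun x hx => ?_
  have hU := (Matrix.isUnit_iff_isUnit_det _).mp (h.isUnit T hT.le)
  have e : U T *ᵥ ((U T)⁻¹ *ᵥ x) = x := by
    rw [Matrix.mulVec_mulVec, Matrix.mul_nonsing_inv _ hU, Matrix.one_mulVec]
  have := h.lt_conj hG hW hc hT (x := (U T)⁻¹ *ᵥ x) (fun h => hx (by rw [← e, h]; simp))
  rw [e] at this
  simpa using (h0.quad_nonneg _).trans_lt this

/-- Conjugating the difference by the adjoint flow of one of the two solutions leaves a derivative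
quadratic in the difference. No order between the initial values is needed, which matters for
solutions not comparable at time `0`. -/
theorem posSemidef_conj_sub_sub (hX : ClosedLoop A W G X U) (hY : ClosedLoop A W G Y UY)
    (hG : IsSwitching τ G) (hW : W.PosSemidef) (hX0 : (X 0).PosSemidef) (hY0 : (Y 0).PosSemidef)
    {t : ℝ} (ht : 0 ≤ t) :
    ((UY t)ᵀ * (Y t - X t) * UY t - (Y 0 - X 0)).PosSemidef := by
  have hd : HasRightDeriv (fun t => (UY t)ᵀ * (Y t - X t) * UY t)
      (fun t => ((Y t - X t) * UY t)ᵀ * G t * ((Y t - X t) * UY t)) := by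
    refine ((hY.adjoint.transpose.mul (hY.riccati.sub hX.riccati)).mul hY.adjoint).congr_deriv
      fun t ht => ?_
    simp only [Matrix.transpose_add, Matrix.transpose_neg, Matrix.transpose_mul,
      Matrix.transpose_transpose, (hG.posSemidef t).transpose_eq, SensorScheduling.riccati,
      Matrix.transpose_sub, (hX.posSemidef hG hW hX0 ht).transpose_eq,
      (hY.posSemidef hG hW hY0 ht).transpose_eq]
    noncomm_ring
  simpa [hY.initial] using hd.posSemidef_sub (T := t)
    (fun s _ => (hG.posSemidef s).transpose_mul_mul _) t ⟨ht, le_rfl⟩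

theorem mono (hX : ClosedLoop A W G X U) (hY : ClosedLoop A W G Y UY)
    (hG : IsSwitching τ G) (hW : W.PosSemidef) (hX0 : (X 0).PosSemidef)
    (hXY : (Y 0 - X 0).PosSemidef) {t : ℝ} (ht : 0 ≤ t) : (Y t - X t).PosSemidef :=
  posSemidef_of_transpose_mul_mul (hY.isUnit t ht) (by
    have hY0 : (Y 0).PosSemidef := by simpa using hXY.add hX0
    simpa using (hX.posSemidef_conj_sub_sub hY hG hW hX0 hY0 ht).add hXY)

/-- With a different adjoint flow on each side the quadratic terms cancel as well. This gives an
exact formula for the difference of two solutions. -/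
theorem cross_conj (hX : ClosedLoop A W G X U) (hY : ClosedLoop A W G Y UY)
    (hG : IsSwitching τ G) (hW : W.PosSemidef) (hX0 : (X 0).PosSemidef)
    {t : ℝ} (ht : 0 ≤ t) : (U t)ᵀ * (X t - Y t) * UY t = X 0 - Y 0 := by
  simpa [hX.initial, hY.initial] using
    ((hX.adjoint.transpose.mul (hX.riccati.sub hY.riccati)).mul hY.adjoint).eq_initial
    (T := t) (fun s hs => by
      simp only [Matrix.transpose_add, Matrix.transpose_neg, Matrix.transpose_mul,
        Matrix.transpose_transpose, (hG.posSemidef s).transpose_eq, SensorScheduling.riccati,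
        (hX.posSemidef hG hW hX0 hs.1).transpose_eq]
      noncomm_ring) t ⟨ht, le_rfl⟩

/-- A subsolution `P` of the equation for `X⁻¹` which increases over `[0, T]` forces `X` to
decrease. -/
theorem posSemidef_sub_of_subsolution (h : ClosedLoop A W G X U) (hG : IsSwitching τ G)
    (hW : W.PosSemidef) (h0 : (X 0).PosSemidef) {P P' : ℝ → Matrix (Fin n) (Fin n) ℝ}
    (hP : HasRightDeriv P P') (hPs : ∀ t, 0 ≤ t → (P t)ᵀ = P t) {T : ℝ} (hT : 0 ≤ T)
    (hsub : ∀ t ∈ Ico 0 T, (G t - P t * A - Aᵀ * P t - P t * W * P t - P' t).PosSemidef)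
    (hP0 : (P 0).PosSemidef) (hPX : P 0 * X 0 = 1) (hPT : (P T - P 0).PosSemidef) :
    (X 0 - X T).PosSemidef := by
  have hV : HasRightDeriv (fun t => X t * U t) (fun t => (A * X t + W) * U t) :=
    (h.riccati.mul h.adjoint).congr_deriv fun t _ => by
      rw [SensorScheduling.riccati]; noncomm_ring
  have hXs : ∀ t, 0 ≤ t → (X t)ᵀ = X t := fun t ht => (h.posSemidef hG hW h0 ht).transpose_eq
  -- The quantity is `Uᵀ (X - X P X) U`, zero at time `0`. It replaces the comparison of `X⁻¹` with
  -- `P`, so `P` need not be invertible at later times.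
  have hd : HasRightDeriv (fun t => (X t * U t)ᵀ * U t - (X t * U t)ᵀ * P t * (X t * U t))
      (fun t => ((1 - P t * X t) * U t)ᵀ * W * ((1 - P t * X t) * U t)
        + (X t * U t)ᵀ * (G t - P t * A - Aᵀ * P t - P t * W * P t - P' t) * (X t * U t)) := by
    refine ((hV.transpose.mul h.adjoint).sub ((hV.transpose.mul hP).mul hV)).congr_deriv
      fun t ht => ?_
    simp only [Matrix.transpose_add, Matrix.transpose_mul, Matrix.transpose_one,
      Matrix.transpose_sub, hXs t ht, hPs t ht, hW.transpose_eq]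
    noncomm_ring
  have h1 := hd.posSemidef_sub (T := T) (fun t ht =>
    (hW.transpose_mul_mul _).add ((hsub t ht).transpose_mul_mul _)) T ⟨hT, le_rfl⟩
  have hXP : X 0 * P 0 = 1 := by
    simpa [hXs 0 le_rfl, hPs 0 le_rfl] using congrArg Matrix.transpose hPX
  have h2 : (X T - X T * P T * X T).PosSemidef := by
    refine posSemidef_of_transpose_mul_mul (h.isUnit T hT) ?_
    convert h1 using 1
    simp only [h.initial, Matrix.transpose_mul, hXs T hT, hXs 0 le_rfl, mul_one,
      one_mul, hXP]
    noncomm_ring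
  -- Completing the square with `P 0 = (X 0)⁻¹`: these three nonnegative terms add up to `X 0 - X
  -- T`.
  have h3 := (hPT.transpose_mul_mul (X T)).add ((hP0.transpose_mul_mul (X T - X 0)).add h2)
  convert h3 using 1
  rw [Matrix.transpose_sub, hXs T hT, hXs 0 le_rfl]
  have e : (X T - X 0) * P 0 * (X T - X 0) = X T * P 0 * X T - X T * (P 0 * X 0)
      - (X 0 * P 0) * X T + X 0 * P 0 * X 0 := by noncomm_ring
  rw [e, hPX, hXP]
  noncomm_ring

end ClosedLoop

end Matrix

/-! ### Quadratic forms and limits of positive semidefinite matrices -/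

section Limits

variable {n : ℕ}

theorem continuous_quad (M : Matrix (Fin n) (Fin n) ℝ) :
    Continuous fun x : Fin n → ℝ => x ⬝ᵥ M *ᵥ x := by
  fun_prop

theorem quad_smul (M : Matrix (Fin n) (Fin n) ℝ) (c : ℝ) (x : Fin n → ℝ) :
    (c • x) ⬝ᵥ M *ᵥ (c • x) = c ^ 2 * (x ⬝ᵥ M *ᵥ x) := by
  simp only [Matrix.mulVec_smul, dotProduct_smul, smul_dotProduct, smul_eq_mul]; ring

/-- A quadratic form which exceeds `a` on the unit sphere is at least `a ‖x‖²`. -/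
theorem quad_ge_of_sphere {M : Matrix (Fin n) (Fin n) ℝ} {a : ℝ}
    (h : ∀ x ∈ Metric.sphere (0 : Fin n → ℝ) 1, a ≤ x ⬝ᵥ M *ᵥ x) (x : Fin n → ℝ) :
    a * ‖x‖ ^ 2 ≤ x ⬝ᵥ M *ᵥ x := by
  rcases eq_or_ne x 0 with rfl | hx
  · simp
  have hx' : 0 < ‖x‖ := norm_pos_iff.mpr hx
  have h1 := h (‖x‖⁻¹ • x) (by simp [norm_smul, hx'.ne'])
  rw [quad_smul] at h1
  have h2 := mul_le_mul_of_nonneg_left h1 (sq_nonneg ‖x‖)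
  have h3 : ‖x‖ ^ 2 * (‖x‖⁻¹ ^ 2 * (x ⬝ᵥ M *ᵥ x)) = x ⬝ᵥ M *ᵥ x := by
    field_simp
  linarith

theorem exists_pos_le_quad {M : Matrix (Fin n) (Fin n) ℝ} (h : ∀ x ≠ 0, 0 < x ⬝ᵥ M *ᵥ x) :
    ∃ a > 0, ∀ x, a * ‖x‖ ^ 2 ≤ x ⬝ᵥ M *ᵥ x := by
  suffices h : ∃ a > 0, ∀ x ∈ Metric.sphere (0 : Fin n → ℝ) 1, a ≤ x ⬝ᵥ M *ᵥ x by
    obtain ⟨a, ha, h⟩ := h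
    exact ⟨a, ha, quad_ge_of_sphere h⟩
  rcases (Metric.sphere (0 : Fin n → ℝ) 1).eq_empty_or_nonempty with he | hne
  · exact ⟨1, one_pos, fun x hx => by simp [he] at hx⟩
  obtain ⟨x, hx, hmin⟩ := (isCompact_sphere (0 : Fin n → ℝ) 1).exists_isMinOn hne
    (continuous_quad M).continuousOn
  exact ⟨_, h x (by rintro rfl; simp at hx), hmin⟩

theorem posSemidef_of_tendsto {X : ℕ → Matrix (Fin n) (Fin n) ℝ} {L : Matrix (Fin n) (Fin n) ℝ}
    (h : Tendsto X atTop (𝓝 L)) (hX : ∀ k, (X k).PosSemidef) : L.PosSemidef := by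
  refine Matrix.PosSemidef.of_dotProduct_mulVec_nonneg ?_ fun v => ?_
  · have h1 : Tendsto (fun k => (X k)ᵀ) atTop (𝓝 Lᵀ) :=
      (continuous_id.matrix_transpose.tendsto L).comp h
    have h2 : (fun k => (X k)ᵀ) = X := by
      funext k
      simpa using (hX k).isHermitian.eq
    rw [h2] at h1
    rw [Matrix.IsHermitian, Matrix.conjTranspose_eq_transpose_of_trivial]
    exact tendsto_nhds_unique h1 h
  · have hc : Continuous fun M : Matrix (Fin n) (Fin n) ℝ => star v ⬝ᵥ M *ᵥ v := by fun_prop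
    exact ge_of_tendsto' ((hc.tendsto L).comp h) fun k => (hX k).dotProduct_mulVec_nonneg v

/-- Decreasing sequences of positive semidefinite matrices converge. -/
theorem exists_tendsto_of_antitone {X : ℕ → Matrix (Fin n) (Fin n) ℝ}
    (hX : ∀ k, (X k).PosSemidef) (hd : ∀ k, (X k - X (k + 1)).PosSemidef) :
    ∃ L, Tendsto X atTop (𝓝 L) := by
  have hq : ∀ v : Fin n → ℝ, ∃ l, Tendsto (fun k => v ⬝ᵥ X k *ᵥ v) atTop (𝓝 l) := fun v => by
    refine ⟨_, tendsto_atTop_ciInf (antitone_nat_of_succ_le fun k => ?_) ⟨0, ?_⟩⟩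
    · have := (hd k).dotProduct_mulVec_nonneg v
      rw [Matrix.sub_mulVec, dotProduct_sub] at this
      simpa using this
    · rintro _ ⟨k, rfl⟩
      simpa using (hX k).dotProduct_mulVec_nonneg v
  choose l hl using hq
  -- Polarisation recovers the entries of the limit from the limits of the quadratic forms.
  refine ⟨fun i j => (l (Pi.single i 1 + Pi.single j 1) - l (Pi.single i 1)
    - l (Pi.single j 1)) / 2, tendsto_pi_nhds.mpr fun i => tendsto_pi_nhds.mpr fun j => ?_⟩
  refine ((((hl (Pi.single i 1 + Pi.single j 1)).sub (hl (Pi.single i 1))).sub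
    (hl (Pi.single j 1))).div_const 2).congr fun k => ?_
  have hs : X k j i = X k i j := by
    simpa using congrFun (congrFun (hX k).isHermitian.eq i) j
  simp [Matrix.mulVec_add, add_dotProduct, dotProduct_add, hs]
  ring

end Limits

/-! ### Norm estimates, Floquet theory and stability of the closed loop. -/

section Matrix

attribute [local instance] Matrix.linftyOpNormedRing Matrix.linftyOpNormedAlgebra

variable {n : ℕ} {A W : Matrix (Fin n) (Fin n) ℝ} {τ : ℝ}
  {G X Y U UY : ℝ → Matrix (Fin n) (Fin n) ℝ}

theorem norm_mulVec_le (M : Matrix (Fin n) (Fin n) ℝ) (x : Fin n → ℝ) :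
    ‖M *ᵥ x‖ ≤ ‖M‖ * ‖x‖ :=
  Matrix.linfty_opNorm_mulVec M x

theorem quad_le (M : Matrix (Fin n) (Fin n) ℝ) (x : Fin n → ℝ) :
    x ⬝ᵥ M *ᵥ x ≤ n * ‖M‖ * ‖x‖ ^ 2 := by
  calc x ⬝ᵥ M *ᵥ x ≤ ∑ _i : Fin n, ‖x‖ * (‖M‖ * ‖x‖) := by
        refine Finset.sum_le_sum fun i _ => (le_abs_self _).trans ?_
        rw [abs_mul]
        exact mul_le_mul (norm_le_pi_norm x i)
          ((norm_le_pi_norm (M *ᵥ x) i).trans (norm_mulVec_le M x)) (abs_nonneg _) (norm_nonneg _)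
    _ = _ := by simp; ring

theorem norm_le_of_mulVec {M : Matrix (Fin n) (Fin n) ℝ} {b : ℝ} (hb : 0 ≤ b)
    (h : ∀ x, ‖M *ᵥ x‖ ≤ b * ‖x‖) : ‖M‖ ≤ b := by
  rw [Matrix.linfty_opNorm_eq_opNorm]
  exact ContinuousLinearMap.opNorm_le_bound _ hb h

/-- An expansion estimate for `U` bounds `U⁻¹`. -/
theorem norm_inv_sq_le {M : Matrix (Fin n) (Fin n) ℝ} (hM : IsUnit M) {a c : ℝ} (ha : 0 < a)
    (hc : 0 ≤ c) (h : ∀ x, a * ‖x‖ ^ 2 ≤ c * ‖M *ᵥ x‖ ^ 2) : ‖M⁻¹‖ ^ 2 ≤ c / a := by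
  have h1 : ‖M⁻¹‖ ≤ √(c / a) := by
    refine norm_le_of_mulVec (Real.sqrt_nonneg _) fun y => ?_
    have h2 := h (M⁻¹ *ᵥ y)
    rw [Matrix.mulVec_mulVec, Matrix.mul_nonsing_inv _ ((Matrix.isUnit_iff_isUnit_det _).mp hM),
      Matrix.one_mulVec] at h2
    refine abs_le_of_sq_le_sq' ?_ (by positivity) |>.2
    rw [mul_pow, Real.sq_sqrt (by positivity), div_mul_eq_mul_div, le_div_iff₀ ha]
    linarith
  calc ‖M⁻¹‖ ^ 2 ≤ √(c / a) ^ 2 := by gcongr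
    _ = c / a := Real.sq_sqrt (by positivity)

/-- The eigenvalues of a matrix whose powers tend to zero lie in the open unit disk. -/
theorem norm_lt_one_of_tendsto_pow {M : Matrix (Fin n) (Fin n) ℝ}
    (h : Tendsto (fun k : ℕ => M ^ k) atTop (𝓝 0)) {μ : ℂ}
    (hμ : μ ∈ spectrum ℂ (M.map (algebraMap ℝ ℂ))) : ‖μ‖ < 1 := by
  rw [spectrum.mem_iff, Matrix.isUnit_iff_isUnit_det, isUnit_iff_ne_zero, not_not] at hμ
  obtain ⟨v, hv0, hv⟩ := Matrix.exists_mulVec_eq_zero_iff.mpr hμ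
  rw [Matrix.sub_mulVec, sub_eq_zero, Algebra.algebraMap_eq_smul_one, Matrix.smul_mulVec,
    Matrix.one_mulVec] at hv
  have hpow : ∀ k : ℕ, ((M ^ k).map (algebraMap ℝ ℂ)) *ᵥ v = μ ^ k • v := fun k => by
    induction k with
    | zero => simp [Matrix.map_one]
    | succ k ih =>
      rw [pow_succ, Matrix.map_mul, ← Matrix.mulVec_mulVec, ← hv, Matrix.mulVec_smul, ih,
        smul_smul, pow_succ, mul_comm]
  have hc : Continuous fun B : Matrix (Fin n) (Fin n) ℝ => (B.map (algebraMap ℝ ℂ)) *ᵥ v := by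
    have : Continuous (algebraMap ℝ ℂ) := Complex.continuous_ofReal
    fun_prop
  have ht := (hc.tendsto 0).comp h
  obtain ⟨i, hi⟩ := Function.ne_iff.mp hv0
  have ht' := ((tendsto_pi_nhds.mp ht) i).norm
  simp only [Function.comp_def, hpow, Pi.smul_apply, smul_eq_mul, norm_mul, norm_pow] at ht'
  have h0 : ((0 : Matrix (Fin n) (Fin n) ℝ).map (algebraMap ℝ ℂ)) *ᵥ v = 0 := by
    rw [Matrix.map_zero _ (map_zero _), Matrix.zero_mulVec]
  rw [h0] at ht'
  by_contra! hge
  have h1 : ‖v i‖ ≤ 0 := by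
    refine ge_of_tendsto' (by simpa using ht') fun k => ?_
    exact le_mul_of_one_le_left (norm_nonneg _) (one_le_pow₀ hge)
  exact hi (norm_le_zero_iff.mp h1)

namespace ClosedLoop

theorem shift (h : ClosedLoop A W G X U) {a : ℝ} (ha : 0 ≤ a) (hG : ∀ t, G (t + a) = G t) :
    ClosedLoop A W G (fun t => X (t + a)) (fun t => U (t + a) * (U a)⁻¹) where
  riccati := (h.riccati.shift ha).congr_deriv fun t _ => by rw [hG]
  initial := by
    simpa using Matrix.mul_nonsing_inv _ ((Matrix.isUnit_iff_isUnit_det _).mp (h.isUnit a ha))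
  adjoint := ((h.adjoint.shift ha).mul_const _).congr_deriv fun t _ => by rw [hG, mul_assoc]
  isUnit t ht := (h.isUnit _ (by positivity)).mul
    ((Matrix.isUnit_nonsing_inv_iff).mpr (h.isUnit a ha))

theorem adjoint_unique (h : ClosedLoop A W G X U) (h' : ClosedLoop A W G X Y)
    (hG : IsSwitching τ G) : ∀ t, 0 ≤ t → U t = Y t := by
  intro T hT
  obtain ⟨a, ha⟩ := exists_norm_le_of_continuousOn h.riccati.cont T
  obtain ⟨c, hc⟩ := hG.exists_bound (‖·‖)
  have := (h.adjoint.sub h'.adjoint).eq_zero_of_norm_le (by simp [h.initial, h'.initial]) (T := T)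
    (K := ‖-Aᵀ‖ + c * a) (fun t ht => by
      have ht' := Ico_subset_Icc_self ht
      have hc0 := (norm_nonneg _).trans (hc t)
      rw [← mul_sub]
      refine (norm_mul_le _ _).trans ?_
      gcongr
      refine (norm_add_le _ _).trans ?_
      gcongr
      exact (norm_mul_le _ _).trans (mul_le_mul (hc t) (ha t ht') (norm_nonneg _) hc0))
    T ⟨hT, le_rfl⟩
  exact sub_eq_zero.mp this

/-- For a periodic solution of the Riccati equation the adjoint satisfies Floquet's identity. -/
theorem floquet (h : ClosedLoop A W G X U) (hG : IsSwitching τ G)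
    (hX : ∀ t, 0 ≤ t → X (t + τ) = X t) {t : ℝ} (ht : 0 ≤ t) : U (t + τ) = U t * U τ := by
  have h1 := h.shift hG.pos.le hG.periodic
  have h2 : ClosedLoop A W G X (fun t => U (t + τ) * (U τ)⁻¹) :=
    { riccati := h.riccati
      initial := h1.initial
      adjoint := h1.adjoint.congr_deriv fun t ht => by rw [hX t ht]
      isUnit := h1.isUnit }
  rw [h.adjoint_unique h2 hG t ht]
  exact (Matrix.nonsing_inv_mul_cancel_right _ _
    ((Matrix.isUnit_iff_isUnit_det _).mp (h.isUnit τ hG.pos.le))).symm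

theorem floquet_pow (h : ClosedLoop A W G X U) (hG : IsSwitching τ G)
    (hX : ∀ t, 0 ≤ t → X (t + τ) = X t) (k : ℕ) : U (k * τ) = U τ ^ k := by
  have := hG.pos
  induction k with
  | zero => simp [h.initial]
  | succ k ih =>
    rw [pow_succ, ← ih, ← h.floquet hG hX (by positivity)]
    congr 1; push_cast; ring

/-- The positive definite form `X 0` expands by a fixed factor `q > 1` under each period of `U`, so
`U⁻¹` decays geometrically. -/
theorem exists_norm_inv_le (h : ClosedLoop A W G X U) (hG : IsSwitching τ G)
    (hW : W.PosSemidef) (hc : IsControllable A (CFC.sqrt W)) (h0 : (X 0).PosSemidef)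
    (hX : ∀ t, 0 ≤ t → X (t + τ) = X t) :
    ∃ c r : ℝ, 0 ≤ c ∧ 0 ≤ r ∧ r < 1 ∧
      ∀ t, 0 ≤ t → ‖(U t)⁻¹‖ ^ 2 ≤ c * r ^ ⌊t / τ⌋₊ := by
  have hτ := hG.pos
  have hXk : ∀ (k : ℕ) (t : ℝ), 0 ≤ t → X (t + k * τ) = X t := fun k => by
    induction k with
    | zero => simp
    | succ k ih =>
      intro t ht
      rw [← ih t ht, ← hX (t + k * τ) (by positivity)]
      congr 1; push_cast; ring
  have hpd : (X 0).PosDef := by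
    have := h.posDef hG hW hc h0 hτ
    rwa [← zero_add τ, hX 0 le_rfl] at this
  obtain ⟨a, ha, hla⟩ := exists_pos_le_quad (M := X 0) fun x hx => by
    simpa using hpd.dotProduct_mulVec_pos hx
  obtain ⟨b, hb, hlb⟩ := exists_pos_le_quad (M := (U τ)ᵀ * X 0 * U τ - X 0) fun x hx => by
    have h1 := h.lt_conj hG hW hc hτ hx
    have h2 : X τ = X 0 := by simpa using hX 0 le_rfl
    rw [h2] at h1
    rw [Matrix.sub_mulVec, dotProduct_sub, dotProduct_conj]
    linarith
  obtain ⟨K, hK⟩ := exists_norm_le_of_continuousOn h.riccati.cont τ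
  -- The gain over a period is at least `b ‖x‖²`, while the form itself is at most `n ‖X 0‖ ‖x‖²`.
  -- The summand `1` keeps the denominator positive.
  set q : ℝ := 1 + b / (n * ‖X 0‖ + 1) with hq
  have hq1 : 1 < q := by
    have : 0 < b / (n * ‖X 0‖ + 1) := by positivity
    linarith
  have hstep : ∀ x, q * (x ⬝ᵥ X 0 *ᵥ x) ≤ (U τ *ᵥ x) ⬝ᵥ X 0 *ᵥ (U τ *ᵥ x) := fun x => by
    have h1 := hlb x
    rw [Matrix.sub_mulVec, dotProduct_sub, dotProduct_conj] at h1
    have h2 : b / (n * ‖X 0‖ + 1) * (x ⬝ᵥ X 0 *ᵥ x) ≤ b * ‖x‖ ^ 2 := by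
      rw [div_mul_eq_mul_div, div_le_iff₀ (by positivity)]
      nlinarith [quad_le (X 0) x, sq_nonneg ‖x‖]
    rw [hq, add_mul, one_mul]
    linarith
  have hpow : ∀ (k : ℕ) x, q ^ k * (x ⬝ᵥ X 0 *ᵥ x) ≤
      (U (k * τ) *ᵥ x) ⬝ᵥ X 0 *ᵥ (U (k * τ) *ᵥ x) := fun k => by
    induction k with
    | zero => simp [h.initial]
    | succ k ih =>
      intro x
      have h1 := (mul_le_mul_of_nonneg_left (ih x) (by linarith : 0 ≤ q)).trans
        (hstep (U (k * τ) *ᵥ x))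
      rw [Matrix.mulVec_mulVec, h.floquet_pow hG hX, ← pow_succ', ← h.floquet_pow hG hX] at h1
      rw [pow_succ']
      linarith
  have hK0 : 0 ≤ K := (norm_nonneg _).trans (hK 0 ⟨le_rfl, hτ.le⟩)
  refine ⟨n * K / a, q⁻¹, by positivity, by positivity, inv_lt_one_of_one_lt₀ hq1,
    fun t ht => ?_⟩
  set k := ⌊t / τ⌋₊
  have hkt : k * τ ≤ t := (le_div_iff₀ hτ).mp (Nat.floor_le (by positivity))
  have hkt' : t - k * τ ≤ τ := by
    have := (div_lt_iff₀ hτ).mp (Nat.lt_floor_add_one (t / τ))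
    linarith
  have hKt : ‖X t‖ ≤ K := by
    have := hXk k (t - k * τ) (by linarith)
    rw [sub_add_cancel] at this
    rw [this]
    exact hK _ ⟨by linarith, hkt'⟩
  have hq0 : 0 < q ^ k := by positivity
  have h2 : n * K / a * q⁻¹ ^ k = n * K / (q ^ k * a) := by
    rw [inv_pow]; field_simp
  rw [h2]
  refine norm_inv_sq_le (h.isUnit t ht) (by positivity) (by positivity) fun x => ?_
  -- Inside an incomplete period the form does not decrease, so the estimate at the last multiple of
  -- `τ` carries over to `t`.
  have h3 := (h.shift (a := k * τ) (by positivity) fun t => by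
    simpa using hG.periodic.nat_mul k t).posSemidef_conj_sub hG hW (t := t - k * τ) (by linarith)
  have h4 := h3.quad_nonneg (U (k * τ) *ᵥ x)
  have h5 : (U t * (U (k * τ))⁻¹) *ᵥ (U (k * τ) *ᵥ x) = U t *ᵥ x := by
    rw [Matrix.mulVec_mulVec, Matrix.nonsing_inv_mul_cancel_right _ _
      ((Matrix.isUnit_iff_isUnit_det _).mp (h.isUnit _ (by positivity)))]
  simp only [sub_add_cancel, Matrix.sub_mulVec, dotProduct_sub, dotProduct_conj, h5,
    hXk k 0 le_rfl] at h4
  calc q ^ k * a * ‖x‖ ^ 2 ≤ q ^ k * (x ⬝ᵥ X 0 *ᵥ x) := by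
        rw [mul_assoc]; exact mul_le_mul_of_nonneg_left (hla x) hq0.le
    _ ≤ (U (k * τ) *ᵥ x) ⬝ᵥ X 0 *ᵥ (U (k * τ) *ᵥ x) := hpow k x
    _ ≤ (U t *ᵥ x) ⬝ᵥ X t *ᵥ (U t *ᵥ x) := by linarith
    _ ≤ n * ‖X t‖ * ‖U t *ᵥ x‖ ^ 2 := quad_le _ _
    _ ≤ n * K * ‖U t *ᵥ x‖ ^ 2 := by gcongr

theorem tendsto_inv (h : ClosedLoop A W G X U) (hG : IsSwitching τ G)
    (hW : W.PosSemidef) (hc : IsControllable A (CFC.sqrt W)) (h0 : (X 0).PosSemidef)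
    (hX : ∀ t, 0 ≤ t → X (t + τ) = X t) : Tendsto (fun t => (U t)⁻¹) atTop (𝓝 0) := by
  obtain ⟨c, r, -, hr0, hr1, hb⟩ := h.exists_norm_inv_le hG hW hc h0 hX
  have h1 : Tendsto (fun t : ℝ => c * r ^ ⌊t / τ⌋₊) atTop (𝓝 0) := by
    have := ((tendsto_pow_atTop_nhds_zero_of_lt_one hr0 hr1).comp
      (tendsto_nat_floor_atTop.comp (tendsto_id.atTop_div_const hG.pos))).const_mul c
    simpa [Function.comp_def] using this
  have h2 : Tendsto (fun t => ‖(U t)⁻¹‖ ^ 2) atTop (𝓝 0) :=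
    squeeze_zero' (Eventually.of_forall fun t => by positivity)
      ((eventually_ge_atTop 0).mono hb) h1
  have h3 := h2.sqrt
  simp only [Real.sqrt_sq (norm_nonneg _), Real.sqrt_zero] at h3
  exact tendsto_zero_iff_norm_tendsto_zero.mpr h3

/-- The closed loop of a periodic positive semidefinite solution is asymptotically stable. -/
theorem multipliers (h : ClosedLoop A W G X U) (hG : IsSwitching τ G)
    (hW : W.PosSemidef) (hc : IsControllable A (CFC.sqrt W)) (h0 : (X 0).PosSemidef)
    (hX : ∀ t, 0 ≤ t → X (t + τ) = X t) {F : ℝ → Matrix (Fin n) (Fin n) ℝ}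
    (hF : ∀ t, 0 ≤ t → F t = A - X t * G t) :
    MultipliersSatisfy τ F (fun μ => ‖μ‖ < 1) := by
  have hτ := hG.pos
  -- The inverse transpose of the adjoint flow is the fundamental matrix of the closed loop `A - X
  -- G`.
  have hΦ : HasRightDeriv (fun t => ((U t)⁻¹)ᵀ) (fun t => F t * ((U t)⁻¹)ᵀ) := by
    refine (h.adjoint.inv h.isUnit).transpose.congr_deriv fun t ht => ?_
    have h1 : U t * (U t)⁻¹ = 1 :=
      Matrix.mul_nonsing_inv _ ((Matrix.isUnit_iff_isUnit_det _).mp (h.isUnit t ht))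
    rw [hF t ht, ← mul_assoc, mul_assoc _ (U t), h1, mul_one]
    simp only [Matrix.transpose_add, Matrix.transpose_neg, Matrix.transpose_mul,
      Matrix.transpose_transpose, (hG.posSemidef t).transpose_eq,
      (h.posSemidef hG hW h0 ht).transpose_eq]
    noncomm_ring
  refine ⟨_, ⟨by simp [h.initial], hΦ.cont, hΦ.deriv⟩, fun μ hμ =>
    norm_lt_one_of_tendsto_pow ?_ hμ⟩
  have h1 : Tendsto (fun k : ℕ => (U (k * τ))⁻¹) atTop (𝓝 0) :=
    (h.tendsto_inv hG hW hc h0 hX).comp (tendsto_natCast_atTop_atTop.atTop_mul_const hτ)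
  have h2 := (continuous_id.matrix_transpose.tendsto (0 : Matrix (Fin n) (Fin n) ℝ)).comp h1
  rw [id, Matrix.transpose_zero] at h2
  refine h2.congr fun k => ?_
  simp only [Function.comp_apply, id]
  rw [h.floquet_pow hG hX, ← Matrix.inv_pow', Matrix.transpose_pow]

/-- Every solution with positive definite initial value approaches a periodic one. -/
theorem tendsto_sub (hX : ClosedLoop A W G X U) (hG : IsSwitching τ G)
    (hW : W.PosSemidef) (hc : IsControllable A (CFC.sqrt W)) (h0 : (X 0).PosSemidef)
    (hXp : ∀ t, 0 ≤ t → X (t + τ) = X t)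
    (hY : HasRightDeriv Y (fun t => SensorScheduling.riccati A W (G t) (Y t)))
    (hY0 : (Y 0).PosDef) : Tendsto (fun t => Y t - X t) atTop (𝓝 0) := by
  obtain ⟨UY, hY⟩ := hG.exists_adjoint hW hY hY0.posSemidef
  have hτ := hG.pos
  obtain ⟨c, r, hc0, hr0, hr1, hb⟩ := hX.exists_norm_inv_le hG hW hc h0 hXp
  obtain ⟨a, ha, hla⟩ := exists_pos_le_quad (M := Y 0) fun x hx => by
    simpa using hY0.dotProduct_mulVec_pos hx
  obtain ⟨K, hK⟩ := exists_norm_le_of_continuousOn hX.riccati.cont τ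
  have hK0 : 0 ≤ K := (norm_nonneg _).trans (hK 0 ⟨le_rfl, hτ.le⟩)
  have hKt : ∀ t, 0 ≤ t → ‖X t‖ ≤ K := by
    have : ∀ (k : ℕ), ∀ t ∈ Icc 0 ((k + 1) * τ), ‖X t‖ ≤ K := fun k => by
      induction k with
      | zero => simpa using hK
      | succ k ih =>
        intro t ht
        rcases le_or_gt t τ with h | h
        · exact hK t ⟨ht.1, h⟩
        · have e := hXp (t - τ) (by linarith)
          rw [sub_add_cancel] at e
          rw [e]
          refine ih _ ⟨by linarith, ?_⟩
          have := ht.2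
          push_cast at this
          linarith
    intro t ht
    exact this ⌊t / τ⌋₊ t ⟨ht, by
      have := (div_lt_iff₀ hτ).mp (Nat.lt_floor_add_one (t / τ)); linarith⟩
  set B : ℝ := n * K + n * ‖Y 0 - X 0‖ * c with hB
  have hB0 : 0 ≤ B := by positivity
  -- `Y` is bounded above by `X` plus the initial difference transported by `U⁻¹`, which is bounded.
  have hquad : ∀ t, 0 ≤ t → ∀ y, y ⬝ᵥ Y t *ᵥ y ≤ B * ‖y‖ ^ 2 := fun t ht y => by
    have h1 := (hY.posSemidef_conj_sub_sub hX hG hW hY0.posSemidef h0 ht).quad_nonneg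
      ((U t)⁻¹ *ᵥ y)
    have h2 : U t *ᵥ ((U t)⁻¹ *ᵥ y) = y := by
      rw [Matrix.mulVec_mulVec, Matrix.mul_nonsing_inv _
        ((Matrix.isUnit_iff_isUnit_det _).mp (hX.isUnit t ht)), Matrix.one_mulVec]
    rw [Matrix.sub_mulVec, dotProduct_sub, dotProduct_conj, h2, Matrix.sub_mulVec,
      dotProduct_sub] at h1
    have h3 := quad_le (Y 0 - X 0) ((U t)⁻¹ *ᵥ y)
    have h4 : ‖(U t)⁻¹ *ᵥ y‖ ^ 2 ≤ c * ‖y‖ ^ 2 := by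
      calc ‖(U t)⁻¹ *ᵥ y‖ ^ 2 ≤ (‖(U t)⁻¹‖ * ‖y‖) ^ 2 := by
            gcongr; exact norm_mulVec_le _ _
        _ = ‖(U t)⁻¹‖ ^ 2 * ‖y‖ ^ 2 := by ring
        _ ≤ c * ‖y‖ ^ 2 := by
            gcongr
            exact (hb t ht).trans (mul_le_of_le_one_right hc0 (pow_le_one₀ hr0 hr1.le))
    have h5 : y ⬝ᵥ X t *ᵥ y ≤ n * K * ‖y‖ ^ 2 :=
      (quad_le _ _).trans (by gcongr; exact hKt t ht)
    have h6 : n * ‖Y 0 - X 0‖ * ‖(U t)⁻¹ *ᵥ y‖ ^ 2 ≤ n * ‖Y 0 - X 0‖ * (c * ‖y‖ ^ 2) := by gcongr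
    have h7 : Y 0 - X 0 = -(X 0 - Y 0) := by abel
    have h8 : ((U t)⁻¹ *ᵥ y) ⬝ᵥ (X 0 - Y 0) *ᵥ ((U t)⁻¹ *ᵥ y)
        = -(((U t)⁻¹ *ᵥ y) ⬝ᵥ (Y 0 - X 0) *ᵥ ((U t)⁻¹ *ᵥ y)) := by
      rw [h7, Matrix.neg_mulVec, dotProduct_neg, neg_neg]
    rw [h8] at h1
    rw [hB]
    nlinarith
  -- `UYᵀ Y UY ⪰ Y 0 ≻ 0` together with the upper bound on `Y` bounds `UY⁻¹`. Positive definiteness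
  -- of `Y 0` enters here.
  have hUY : ∀ t, 0 ≤ t → ‖(UY t)⁻¹‖ ≤ √(B / a) := fun t ht => by
    refine Real.le_sqrt_of_sq_le (norm_inv_sq_le (hY.isUnit t ht) ha hB0 fun x => ?_)
    have h1 := (hY.posSemidef_conj_sub hG hW ht).quad_nonneg x
    rw [Matrix.sub_mulVec, dotProduct_sub, dotProduct_conj] at h1
    linarith [hla x, hquad t ht (UY t *ᵥ x)]
  have hUt := (continuous_id.matrix_transpose.tendsto (0 : Matrix (Fin n) (Fin n) ℝ)).comp
    (hX.tendsto_inv hG hW hc h0 hXp)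
  simp only [Function.comp_def, id, Matrix.transpose_zero] at hUt
  -- In this product the left factor tends to zero and the right factor is bounded.
  have key : ∀ t, 0 ≤ t → Y t - X t = ((U t)⁻¹)ᵀ * (Y 0 - X 0) * (UY t)⁻¹ := fun t ht => by
    have h1 := hX.cross_conj hY hG hW h0 ht
    have h2 : (U t)ᵀ * (Y t - X t) * UY t = Y 0 - X 0 := by
      rw [← neg_sub (X t), ← neg_sub (X 0), ← h1]; noncomm_ring
    rw [← h2]
    have h3 : ((U t)⁻¹)ᵀ * (U t)ᵀ = 1 := by
      rw [← Matrix.transpose_mul, Matrix.mul_nonsing_inv _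
        ((Matrix.isUnit_iff_isUnit_det _).mp (hX.isUnit t ht)), Matrix.transpose_one]
    have h4 : UY t * (UY t)⁻¹ = 1 :=
      Matrix.mul_nonsing_inv _ ((Matrix.isUnit_iff_isUnit_det _).mp (hY.isUnit t ht))
    calc Y t - X t = (((U t)⁻¹)ᵀ * (U t)ᵀ) * (Y t - X t) * (UY t * (UY t)⁻¹) := by
          rw [h3, h4, one_mul, mul_one]
      _ = _ := by noncomm_ring
  have hlim : Tendsto (fun t => ‖((U t)⁻¹)ᵀ‖ * ‖Y 0 - X 0‖ * √(B / a)) atTop (𝓝 0) := by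
    simpa using (hUt.norm.mul_const ‖Y 0 - X 0‖).mul_const √(B / a)
  refine tendsto_zero_iff_norm_tendsto_zero.mpr (squeeze_zero'
    (Eventually.of_forall fun t => norm_nonneg _) ((eventually_ge_atTop 0).mono fun t ht => ?_)
    hlim)
  rw [key t ht]
  refine (norm_mul_le _ _).trans ?_
  gcongr
  · exact norm_mul_le _ _
  · exact hUY t ht

end ClosedLoop

end Matrix

/-! ### Periodic solutions -/

/-- Strong periodic solutions live on the whole line. Reading the extension through any sufficiently
large shift `k` reduces local statements at negative times to statements about `f` on the half-line.
-/
theorem exists_periodic_extension {E : Type*} {f : ℝ → E} {τ : ℝ} (hτ : 0 < τ)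
    (hf : ∀ t, 0 ≤ t → f (t + τ) = f t) :
    ∃ g : ℝ → E, Function.Periodic g τ ∧
      ∀ (k : ℕ) (t : ℝ), -(k * τ) ≤ t → g t = f (t + k * τ) := by
  have hiter : ∀ (k : ℕ) (t : ℝ), 0 ≤ t → f (t + k * τ) = f t := fun k => by
    induction k with
    | zero => simp
    | succ k ih =>
      intro t ht
      rw [← ih t ht, ← hf (t + k * τ) (by positivity)]
      congr 1; push_cast; ring
  have key : ∀ (k : ℕ) (t : ℝ), -(k * τ) ≤ t → f (t + ⌈-t / τ⌉₊ * τ) = f (t + k * τ) := by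
    intro k t hk
    have h1 : ⌈-t / τ⌉₊ ≤ k := Nat.ceil_le.mpr ((div_le_iff₀ hτ).mpr (by linarith))
    have h2 : -t ≤ ⌈-t / τ⌉₊ * τ := (div_le_iff₀ hτ).mp (Nat.le_ceil _)
    obtain ⟨d, hd⟩ := Nat.exists_eq_add_of_le h1
    rw [← hiter d _ (by linarith)]
    congr 1
    conv_rhs => rw [hd]
    push_cast; ring
  refine ⟨fun t => f (t + ⌈-t / τ⌉₊ * τ), fun t => ?_, key⟩
  obtain ⟨k, hk⟩ := exists_nat_ge (-t / τ)
  rw [div_le_iff₀ hτ] at hk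
  have h3 := key (k + 1) t (by push_cast; linarith)
  have h4 := key k (t + τ) (by linarith)
  simp only [h3, h4]
  congr 1; push_cast; ring

section Matrix

attribute [local instance] Matrix.linftyOpNormedRing Matrix.linftyOpNormedAlgebra

variable {n : ℕ} {A W : Matrix (Fin n) (Fin n) ℝ} {τ : ℝ}
  {G X U : ℝ → Matrix (Fin n) (Fin n) ℝ}

/-- A solution which decreases over one period converges to a periodic one. -/
theorem ClosedLoop.exists_periodic (h : ClosedLoop A W G X U) (hG : IsSwitching τ G)
    (hW : W.PosSemidef) (h0 : (X 0).PosSemidef) (hd : (X 0 - X τ).PosSemidef) :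
    ∃ Z UZ : ℝ → Matrix (Fin n) (Fin n) ℝ, ClosedLoop A W G Z UZ ∧ (Z 0).PosSemidef ∧
      ∀ t, 0 ≤ t → Z (t + τ) = Z t := by
  have hτ := hG.pos
  have hGk : ∀ (k : ℕ) t, G (t + k * τ) = G t := fun k t => by simpa using hG.periodic.nat_mul k t
  have hXk : ∀ k : ℕ, (X (k * τ)).PosSemidef := fun k => h.posSemidef hG hW h0 (by positivity)
  have hshift := fun k : ℕ => h.shift (a := k * τ) (by positivity) (hGk k)
  have hdec : ∀ k : ℕ, (X (k * τ) - X ((k + 1 : ℕ) * τ)).PosSemidef := fun k => by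
    have := (h.shift hτ.le hG.periodic).mono h hG hW (by simpa using hXk 1) (by simpa using hd)
      (t := k * τ) (by positivity)
    convert this using 3
    push_cast; ring
  obtain ⟨L, hL⟩ := exists_tendsto_of_antitone hXk hdec
  have hLpos : L.PosSemidef := posSemidef_of_tendsto hL hXk
  have hge : ∀ k : ℕ, (X (k * τ) - L).PosSemidef := fun k => by
    refine posSemidef_of_tendsto (X := fun l : ℕ => X (k * τ) - X ((k + l : ℕ) * τ))
      (tendsto_const_nhds.sub (hL.comp (tendsto_add_atTop_nat k) |>.congr fun l => by
        simp [add_comm])) fun l => ?_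
    induction l with
    | zero => simpa using Matrix.PosSemidef.zero
    | succ l ih => simpa [add_assoc] using ih.add (hdec (k + l))
  obtain ⟨Z, UZ, hZ0, hZ⟩ := hG.exists_closedLoop (A := A) hW hLpos
  -- Monotonicity gives `Z τ ⪯ L`; the conjugated comparison with the flow of `Z`, in the limit,
  -- gives `L ⪯ Z τ`. Continuous dependence on the initial value is not needed.
  have hZτ : Z τ = L := by
    have h1 : ∀ k : ℕ, (X ((k + 1 : ℕ) * τ) - Z τ).PosSemidef := fun k => by
      have := hZ.mono (hshift k) hG hW (hZ0 ▸ hLpos) (by simpa [hZ0] using hge k) hτ.le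
      convert this using 3
      push_cast; ring
    have h2 : ∀ k : ℕ, ((UZ τ)ᵀ * (Z τ - X ((k + 1 : ℕ) * τ)) * UZ τ
        - (L - X (k * τ))).PosSemidef := fun k => by
      have := (hshift k).posSemidef_conj_sub_sub hZ hG hW (by simpa using hXk k)
        (hZ0 ▸ hLpos) hτ.le
      simp only [zero_add, hZ0] at this
      convert this using 6
      push_cast; ring
    have hL' := hL.comp (tendsto_add_atTop_nat 1)
    have h3 : (L - Z τ).PosSemidef := posSemidef_of_tendsto (hL'.sub_const (Z τ)) h1
    have h4 : ((UZ τ)ᵀ * (Z τ - L) * UZ τ - (L - L)).PosSemidef :=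
      posSemidef_of_tendsto ((((hL'.const_sub (Z τ)).const_mul _).mul_const _).sub
        (hL.const_sub L)) h2
    rw [sub_self, sub_zero] at h4
    have h5 := posSemidef_of_transpose_mul_mul (hZ.isUnit τ hτ.le) h4
    exact le_antisymm (Matrix.le_iff.mpr h3) (Matrix.le_iff.mpr h5)
  refine ⟨Z, UZ, hZ, hZ0 ▸ hLpos, ?_⟩
  exact hG.riccati_unique (hZ.shift hτ.le hG.periodic).riccati hZ.riccati (by simp [hZτ, hZ0])

/-- Convergence of the filter, given one solution which decreases over a period. -/
theorem ClosedLoop.exists_attracting (h : ClosedLoop A W G X U) (hG : IsSwitching τ G)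
    (hW : W.PosSemidef) (hc : IsControllable A (CFC.sqrt W)) (h0 : (X 0).PosSemidef)
    (hd : (X 0 - X τ).PosSemidef) :
    ∃ Z : ℝ → Matrix (Fin n) (Fin n) ℝ, Continuous Z ∧ Function.Periodic Z τ ∧
      (∀ t, (Z t).PosSemidef) ∧
      (∀ t, HasDerivWithinAt Z (SensorScheduling.riccati A W (G t) (Z t)) (Ici t) t) ∧
      MultipliersSatisfy τ (fun t => A - Z t * G t) (fun μ => ‖μ‖ < 1) ∧
      ∀ Y : ℝ → Matrix (Fin n) (Fin n) ℝ,
        HasRightDeriv Y (fun t => SensorScheduling.riccati A W (G t) (Y t)) → (Y 0).PosDef →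
          Tendsto (fun t => Y t - Z t) atTop (𝓝 0) := by
  have hτ := hG.pos
  obtain ⟨V, UV, hV, hV0, hVp⟩ := h.exists_periodic hG hW h0 hd
  obtain ⟨Z, hZp, hZ⟩ := exists_periodic_extension hτ hVp
  have hZV : ∀ t, 0 ≤ t → Z t = V t := fun t ht => by simpa using hZ 0 t (by simpa using ht)
  have hk : ∀ t : ℝ, ∃ k : ℕ, -(k * τ) < t := fun t => by
    obtain ⟨k, hk⟩ := exists_nat_gt (-t / τ)
    rw [div_lt_iff₀ hτ] at hk
    exact ⟨k, by linarith⟩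
  refine ⟨Z, continuous_iff_continuousAt.mpr fun t => ?_, hZp, fun t => ?_, fun t => ?_, ?_, ?_⟩
  · obtain ⟨k, hk⟩ := hk t
    have h1 : ContinuousAt V (t + k * τ) :=
      hV.riccati.cont.continuousAt (Ici_mem_nhds (by linarith))
    have h2 : ContinuousAt (fun s : ℝ => V (s + k * τ)) t :=
      ContinuousAt.comp (f := fun s : ℝ => s + k * τ) h1 (by fun_prop)
    refine h2.congr ?_
    filter_upwards [Ici_mem_nhds hk] with s hs using (hZ k s hs).symm
  · obtain ⟨k, hk⟩ := hk t
    rw [hZ k t hk.le]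
    exact hV.posSemidef hG hW hV0 (by linarith)
  · obtain ⟨k, hk⟩ := hk t
    have h1 := hV.riccati.deriv (t + k * τ) (by linarith)
    have hGk : G (t + k * τ) = G t := by simpa using hG.periodic.nat_mul k t
    rw [hZ k t hk.le, ← hGk]
    exact (hasDerivWithinAt_Ici_comp_add h1).congr (fun s hs => hZ k s (hk.le.trans hs)) (hZ k t hk.le)
  · exact hV.multipliers hG hW hc hV0 hVp fun t ht => by rw [hZV t ht]
  · intro Y hY hY0
    refine (hV.tendsto_sub hG hW hc hV0 hVp hY hY0).congr' ?_
    filter_upwards [eventually_ge_atTop 0] with t ht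
    rw [hZV t ht]

end Matrix

/-! ### A decreasing solution from a linear matrix inequality for the mean information -/

section Finsler

variable {n : ℕ}

theorem norm_sq_le_dotProduct (x : Fin n → ℝ) : ‖x‖ ^ 2 ≤ x ⬝ᵥ x := by
  have h : ‖x‖ ≤ √(x ⬝ᵥ x) := by
    refine (pi_norm_le_iff_of_nonneg (Real.sqrt_nonneg _)).mpr fun i => Real.le_sqrt_of_sq_le ?_
    rw [Real.norm_eq_abs, sq_abs, sq]
    exact Finset.single_le_sum (f := fun i => x i * x i) (fun i _ => mul_self_nonneg _)
      (Finset.mem_univ i)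
  calc ‖x‖ ^ 2 ≤ √(x ⬝ᵥ x) ^ 2 := by gcongr
    _ = x ⬝ᵥ x := Real.sq_sqrt (Finset.sum_nonneg fun i _ => mul_self_nonneg _)

/-- Finsler's lemma. -/
theorem exists_nat_quad_pos {L O : Matrix (Fin n) (Fin n) ℝ} (hO : ∀ x, 0 ≤ x ⬝ᵥ O *ᵥ x)
    (h : ∀ x ≠ 0, x ⬝ᵥ O *ᵥ x = 0 → 0 < x ⬝ᵥ L *ᵥ x) :
    ∃ c : ℕ, ∀ x ≠ 0, 0 < x ⬝ᵥ (L + (c : ℝ) • O) *ᵥ x := by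
  have hq : ∀ (c : ℝ) x, x ⬝ᵥ (L + c • O) *ᵥ x = x ⬝ᵥ L *ᵥ x + c * (x ⬝ᵥ O *ᵥ x) := fun c x => by
    rw [Matrix.add_mulVec, dotProduct_add, Matrix.smul_mulVec, dotProduct_smul, smul_eq_mul]
  obtain ⟨c, hc⟩ := (isCompact_sphere (0 : Fin n → ℝ) 1).elim_directed_cover
    (fun c : ℕ => {x | 0 < x ⬝ᵥ (L + (c : ℝ) • O) *ᵥ x})
    (fun c => isOpen_lt continuous_const (continuous_quad _))
    (fun x hx => by
      have hx0 : x ≠ 0 := by rintro rfl; simp at hx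
      rcases (hO x).eq_or_lt with h0 | h0
      · exact mem_iUnion.mpr ⟨0, by simpa using h x hx0 h0.symm⟩
      · obtain ⟨c, hc⟩ := exists_nat_gt (-(x ⬝ᵥ L *ᵥ x) / (x ⬝ᵥ O *ᵥ x))
        rw [div_lt_iff₀ h0] at hc
        exact mem_iUnion.mpr ⟨c, by simp only [mem_ofPred_eq, hq]; linarith⟩)
    (Monotone.directed_le fun c d hcd x hx => by
      simp only [mem_ofPred_eq, hq] at hx ⊢
      have : (c : ℝ) ≤ d := by exact_mod_cast hcd
      nlinarith [hO x])
  refine ⟨c, fun x hx => ?_⟩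
  have hx' : 0 < ‖x‖ := norm_pos_iff.mpr hx
  have h1 : 0 < (‖x‖⁻¹ • x) ⬝ᵥ (L + (c : ℝ) • O) *ᵥ (‖x‖⁻¹ • x) :=
    hc (by simp [norm_smul, hx'.ne'])
  rw [quad_smul] at h1
  exact pos_of_mul_pos_right h1 (by positivity)

end Finsler

section Matrix

attribute [local instance] Matrix.linftyOpNormedRing Matrix.linftyOpNormedAlgebra

variable {n : ℕ} {A W Q Γ : Matrix (Fin n) (Fin n) ℝ} {τ : ℝ}
  {G X U : ℝ → Matrix (Fin n) (Fin n) ℝ}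

namespace HasRightDeriv

variable {X' : ℝ → Matrix (Fin n) (Fin n) ℝ}

theorem const_smul (hX : HasRightDeriv X X') (c : ℝ) :
    HasRightDeriv (fun t => c • X t) (fun t => c • X' t) :=
  ⟨hX.cont.const_smul c, fun t ht => (hX.deriv t ht).const_smul c⟩

theorem id_smul (M : Matrix (Fin n) (Fin n) ℝ) :
    HasRightDeriv (fun t => t • M) (fun _ => M) :=
  ⟨by fun_prop, fun t _ =>
    ((hasDerivWithinAt_id t (Ici t)).smul_const M).congr_deriv (one_smul ℝ M)⟩

end HasRightDeriv

/-- The observability Gramian `O(t) = ∫₀ᵗ exp(s A)ᵀ G(s) exp(s A) ds`. -/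
theorem IsSwitching.exists_gramian (hG : IsSwitching τ G) (A : Matrix (Fin n) (Fin n) ℝ) :
    ∃ O : ℝ → Matrix (Fin n) (Fin n) ℝ, O 0 = 0 ∧ HasRightDeriv O
      (fun t => (NormedSpace.exp (t • A))ᵀ * G t * NormedSpace.exp (t • A)) := by
  -- With `W = 0`, `U 0 = 0` and `V 0 = 1` the flow has `V = exp(tA)`, and `exp(tA)ᵀ U` has the
  -- derivative required of the Gramian.
  obtain ⟨U, V, hU0, hV0, hU, hV⟩ := hG.exists_hamiltonian_flow A 0 0 1
  have hVE : ∀ t, 0 ≤ t → V t = NormedSpace.exp (t • A) := fun T hT => by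
    have := (hV.sub (hasRightDeriv_exp' A)).eq_zero_of_norm_le (by simp [hV0]) (T := T) (K := ‖A‖)
      (fun t _ => by
        rw [zero_mul, zero_add, ← mul_sub]
        exact norm_mul_le _ _) T ⟨hT, le_rfl⟩
    exact sub_eq_zero.mp this
  refine ⟨fun t => (NormedSpace.exp (t • A))ᵀ * U t, by simp [hU0], ?_⟩
  refine ((hasRightDeriv_exp' A).transpose.mul hU).congr_deriv fun t ht => ?_
  rw [hVE t ht, Matrix.transpose_mul]
  noncomm_ring

/-- On the states which are invisible for `G` the quadratic form `Q` strictly decreases. -/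
theorem quad_exp_lt (hG : IsSwitching τ G) (hW : W.PosSemidef)
    (hc : IsControllable A (CFC.sqrt W)) (hQ : Q.PosDef)
    (hLMI : (Γ - Q * A - Aᵀ * Q - Q * W * Q).PosSemidef)
    {x : Fin n → ℝ} (hx : x ≠ 0)
    (hΓ : ∀ t ∈ Ico 0 τ, Γ *ᵥ (NormedSpace.exp (t • A) *ᵥ x) = 0) :
    (NormedSpace.exp (τ • A) *ᵥ x) ⬝ᵥ Q *ᵥ (NormedSpace.exp (τ • A) *ᵥ x) < x ⬝ᵥ Q *ᵥ x := by
  by_contra! hle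
  have hE := hasRightDeriv_exp' A
  have hQs := hQ.posSemidef.transpose_eq
  have hq := (((hE.transpose.mul_const Q).mul hE).const_smul (-1)).quad x
  have hd : ∀ t ∈ Ico 0 τ, x ⬝ᵥ ((-1 : ℝ) • ((A * NormedSpace.exp (t • A))ᵀ * Q
      * NormedSpace.exp (t • A) + (NormedSpace.exp (t • A))ᵀ * Q * (A * NormedSpace.exp (t • A))))
        *ᵥ x
      = (NormedSpace.exp (t • A) *ᵥ x) ⬝ᵥ (Γ - Q * A - Aᵀ * Q - Q * W * Q) *ᵥ
          (NormedSpace.exp (t • A) *ᵥ x)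
        + (Q *ᵥ (NormedSpace.exp (t • A) *ᵥ x)) ⬝ᵥ W *ᵥ
          (Q *ᵥ (NormedSpace.exp (t • A) *ᵥ x)) := fun t ht => by
    have h1 : (NormedSpace.exp (t • A) *ᵥ x) ⬝ᵥ Γ *ᵥ (NormedSpace.exp (t • A) *ᵥ x) = 0 := by
      rw [hΓ t ht, dotProduct_zero]
    have h2 : (-1 : ℝ) • ((A * NormedSpace.exp (t • A))ᵀ * Q * NormedSpace.exp (t • A)
        + (NormedSpace.exp (t • A))ᵀ * Q * (A * NormedSpace.exp (t • A)))
        = (NormedSpace.exp (t • A))ᵀ * (-(Aᵀ * Q) - Q * A) * NormedSpace.exp (t • A) := by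
      rw [Matrix.transpose_mul, neg_one_smul]; noncomm_ring
    have h3 : Γ - Q * A - Aᵀ * Q - Q * W * Q
        = Γ + (-(Aᵀ * Q) - Q * A) - Qᵀ * W * Q := by rw [hQs]; abel
    obtain ⟨H, hH⟩ : ∃ H, H = -(Aᵀ * Q) - Q * A := ⟨_, rfl⟩
    rw [h2, dotProduct_conj, h3, ← hH, Matrix.sub_mulVec, Matrix.add_mulVec, dotProduct_sub,
      dotProduct_add, h1, dotProduct_conj W Q]
    ring
  have hz := hq.deriv_eq_zero (T := τ) (fun t ht => by
    rw [hd t ht]; exact add_nonneg (hLMI.quad_nonneg _) (hW.quad_nonneg _)) (by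
      simp only [Matrix.smul_mulVec, dotProduct_smul, dotProduct_conj]
      simpa using hle)
  -- Equality over the period kills both nonnegative terms, and then `Q exp(tA) x` solves the free
  -- adjoint equation unexcited through `W`.
  have key : ∀ t ∈ Ico 0 τ, Q *ᵥ (A *ᵥ (NormedSpace.exp (t • A) *ᵥ x))
      = -(Aᵀ *ᵥ (Q *ᵥ (NormedSpace.exp (t • A) *ᵥ x))) ∧
      W *ᵥ (Q *ᵥ (NormedSpace.exp (t • A) *ᵥ x)) = 0 := fun t ht => by
    have h1 := hz t ht
    rw [hd t ht] at h1
    have h2 := hLMI.quad_nonneg (NormedSpace.exp (t • A) *ᵥ x)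
    have h3 := hW.quad_nonneg (Q *ᵥ (NormedSpace.exp (t • A) *ᵥ x))
    have h4 := hLMI.mulVec_eq_zero (x := NormedSpace.exp (t • A) *ᵥ x) (by linarith)
    have h5 := hW.mulVec_eq_zero (x := Q *ᵥ (NormedSpace.exp (t • A) *ᵥ x)) (by linarith)
    refine ⟨?_, h5⟩
    simp only [Matrix.sub_mulVec, ← Matrix.mulVec_mulVec, hΓ t ht, h5, Matrix.mulVec_zero,
      sub_zero, zero_sub] at h4
    rw [sub_eq_zero] at h4
    rw [← h4, neg_neg]
  have h0 := eq_zero_of_adjoint hW hc ((hE.const_mul Q).mulVec x) hG.pos (fun t ht => by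
    simpa [Matrix.mulVec_mulVec, mul_assoc] using (key t ht).1) (fun t ht => by
    simpa [Matrix.mulVec_mulVec, mul_assoc] using (key t ht).2)
  simp only [zero_smul, NormedSpace.exp_zero, mul_one] at h0
  have := hQ.dotProduct_mulVec_pos hx
  rw [h0, dotProduct_zero] at this
  exact this.false

/-- The Gramian over one period compensates the growth of the quadratic form `Q`. -/
theorem IsSwitching.exists_gramian_ge (hG : IsSwitching τ G) (hW : W.PosSemidef)
    (hc : IsControllable A (CFC.sqrt W)) (hQ : Q.PosDef)
    (hLMI : (Γ - Q * A - Aᵀ * Q - Q * W * Q).PosSemidef)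
    (hΓ : ∀ x : Fin n → ℝ, (∀ t ∈ Ico 0 τ, G t *ᵥ (NormedSpace.exp (t • A) *ᵥ x) = 0) →
      ∀ t ∈ Ico 0 τ, Γ *ᵥ (NormedSpace.exp (t • A) *ᵥ x) = 0) :
    ∃ (O : ℝ → Matrix (Fin n) (Fin n) ℝ) (c : ℕ) (s : ℝ), 0 < s ∧ O 0 = 0 ∧ HasRightDeriv O
      (fun t => (NormedSpace.exp (t • A))ᵀ * G t * NormedSpace.exp (t • A)) ∧
      (∀ t, 0 ≤ t → (O t).PosSemidef) ∧
      (Q - (NormedSpace.exp (τ • A))ᵀ * Q * NormedSpace.exp (τ • A) + (c : ℝ) • O τ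
        - s • 1).PosSemidef := by
  have hτ := hG.pos
  obtain ⟨O, hO0, hO⟩ := hG.exists_gramian A
  have hOpos : ∀ t, 0 ≤ t → (O t).PosSemidef := fun t ht => by
    simpa [hO0] using hO.posSemidef_sub (T := t)
      (fun s _ => (hG.posSemidef s).transpose_mul_mul _) t ⟨ht, le_rfl⟩
  have hstrict : ∀ x ≠ 0, x ⬝ᵥ O τ *ᵥ x = 0 →
      0 < x ⬝ᵥ (Q - (NormedSpace.exp (τ • A))ᵀ * Q * NormedSpace.exp (τ • A)) *ᵥ x := by
    intro x hx hx0
    rw [Matrix.sub_mulVec, dotProduct_sub, dotProduct_conj, sub_pos]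
    refine quad_exp_lt hG hW hc hQ hLMI hx (hΓ x fun t ht => ?_)
    have := (hO.quad x).deriv_eq_zero (T := τ)
      (fun t _ => ((hG.posSemidef t).transpose_mul_mul _).quad_nonneg x) (by simp [hx0, hO0]) t ht
    rw [dotProduct_conj] at this
    exact (hG.posSemidef t).mulVec_eq_zero this
  obtain ⟨c, hcO⟩ := exists_nat_quad_pos (hOpos τ hτ.le).quad_nonneg hstrict
  obtain ⟨a, ha, hla⟩ := exists_pos_le_quad hcO
  have hs0 : 0 < a / (n * ‖(1 : Matrix (Fin n) (Fin n) ℝ)‖ + 1) := by positivity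
  refine ⟨O, c, _, hs0, hO0, hO, hOpos, Matrix.PosSemidef.of_dotProduct_mulVec_nonneg ?_
    fun x => ?_⟩
  · rw [Matrix.IsHermitian, Matrix.conjTranspose_eq_transpose_of_trivial]
    simp only [Matrix.transpose_sub, Matrix.transpose_add, Matrix.transpose_smul,
      Matrix.transpose_one, (hOpos τ hτ.le).transpose_eq, hQ.posSemidef.transpose_eq,
      (hQ.posSemidef.transpose_mul_mul (NormedSpace.exp (τ • A))).transpose_eq]
  · rw [Matrix.sub_mulVec, dotProduct_sub, Matrix.smul_mulVec, dotProduct_smul, smul_eq_mul,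
      star_trivial]
    have h1 := hla x
    have h2 := quad_le (1 : Matrix (Fin n) (Fin n) ℝ) x
    have h3 : a / (n * ‖(1 : Matrix (Fin n) (Fin n) ℝ)‖ + 1)
        * (x ⬝ᵥ (1 : Matrix (Fin n) (Fin n) ℝ) *ᵥ x) ≤ a * ‖x‖ ^ 2 := by
      rw [div_mul_eq_mul_div, div_le_iff₀ (by positivity)]
      nlinarith [sq_nonneg ‖x‖]
    linarith

theorem posSemidef_smul_one_sub {H : Matrix (Fin n) (Fin n) ℝ} (hH : Hᵀ = H) {a δ K : ℝ}
    (hδ : 0 ≤ δ) (hK : ‖H‖ ≤ K) (h : δ * (n * K) ≤ a) :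
    (a • (1 : Matrix (Fin n) (Fin n) ℝ) - δ • H).PosSemidef := by
  refine Matrix.PosSemidef.of_dotProduct_mulVec_nonneg ?_ fun x => ?_
  · rw [Matrix.IsHermitian, Matrix.conjTranspose_eq_transpose_of_trivial]
    simp only [Matrix.transpose_sub, Matrix.transpose_smul, Matrix.transpose_one, hH]
  · have h1 := quad_le H x
    have h0 := norm_sq_le_dotProduct x
    have hK0 := (norm_nonneg _).trans hK
    have h2 : n * ‖H‖ * ‖x‖ ^ 2 ≤ n * K * (x ⬝ᵥ x) := by gcongr
    have h3 : δ * (x ⬝ᵥ H *ᵥ x) ≤ δ * (n * K) * (x ⬝ᵥ x) := by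
      rw [mul_assoc]
      exact mul_le_mul_of_nonneg_left (h1.trans h2) hδ
    have h4 : δ * (n * K) * (x ⬝ᵥ x) ≤ a * (x ⬝ᵥ x) :=
      mul_le_mul_of_nonneg_right h ((sq_nonneg _).trans h0)
    simp only [star_trivial, Matrix.sub_mulVec, dotProduct_sub, Matrix.smul_mulVec,
      dotProduct_smul, smul_eq_mul, Matrix.one_mulVec]
    linarith

/-- The derivative of `δ Fᵀ N F`, where `F` is the inverse of the flow `E` of `A`. -/
theorem hasRightDeriv_transported {E F N : ℝ → Matrix (Fin n) (Fin n) ℝ}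
    (hEF : ∀ t, E t * F t = 1) (hF : HasRightDeriv F (fun t => F t * -A)) {c σ : ℝ}
    (hN : HasRightDeriv N (fun t => c • ((E t)ᵀ * G t * E t) - σ • 1)) (δ : ℝ) :
    HasRightDeriv (fun t => δ • ((F t)ᵀ * N t * F t))
      (fun t => -(Aᵀ * (δ • ((F t)ᵀ * N t * F t))) - (δ • ((F t)ᵀ * N t * F t)) * A
        + (δ * c) • G t - (δ * σ) • ((F t)ᵀ * F t)) := by
  refine (((hF.transpose.mul hN).mul hF).const_smul δ).congr_deriv fun t _ => ?_
  have h1 : (F t)ᵀ * (c • ((E t)ᵀ * G t * E t) - σ • 1) * F t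
      = c • G t - σ • ((F t)ᵀ * F t) := by
    have h2 : (F t)ᵀ * ((E t)ᵀ * G t * E t) * F t = G t := by
      calc _ = ((F t)ᵀ * (E t)ᵀ) * G t * (E t * F t) := by noncomm_ring
        _ = G t := by rw [← Matrix.transpose_mul, hEF, Matrix.transpose_one, one_mul, mul_one]
    rw [mul_sub, sub_mul, Matrix.mul_smul, Matrix.smul_mul, h2, Matrix.mul_smul,
      Matrix.smul_mul, mul_one]
  rw [add_mul, h1]
  simp only [Matrix.transpose_mul, Matrix.transpose_neg, mul_neg, neg_mul, Matrix.mul_smul,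
    Matrix.smul_mul, mul_assoc]
  module

/-- The subsolution is `P = δ Fᵀ N F` with `F = exp(-tA)` and `N = Q + c O - (s/τ) t`. The Gramian
term makes `P` grow over the period, while the slack `s`, spent at a constant rate, pays for the
term `P W P`, which is of second order in `δ`. -/
theorem IsSwitching.exists_decreasing (hG : IsSwitching τ G) (hW : W.PosSemidef)
    (hc : IsControllable A (CFC.sqrt W)) (hQ : Q.PosDef)
    (hLMI : (Γ - Q * A - Aᵀ * Q - Q * W * Q).PosSemidef)
    (hΓ : ∀ x : Fin n → ℝ, (∀ t ∈ Ico 0 τ, G t *ᵥ (NormedSpace.exp (t • A) *ᵥ x) = 0) →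
      ∀ t ∈ Ico 0 τ, Γ *ᵥ (NormedSpace.exp (t • A) *ᵥ x) = 0) :
    ∃ X U, ClosedLoop A W G X U ∧ (X 0).PosSemidef ∧ (X 0 - X τ).PosSemidef := by
  have hτ := hG.pos
  obtain ⟨O, c, s, hs0, hO0, hO, hOpos, hfin⟩ := hG.exists_gramian_ge hW hc hQ hLMI hΓ
  obtain ⟨E, hE⟩ : ∃ E : ℝ → Matrix (Fin n) (Fin n) ℝ, ∀ t, E t = NormedSpace.exp (t • A) :=
    ⟨_, fun _ => rfl⟩
  obtain ⟨F, hF⟩ : ∃ F : ℝ → Matrix (Fin n) (Fin n) ℝ, F = fun t => NormedSpace.exp (t • -A) :=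
    ⟨_, rfl⟩
  simp only [← hE] at hO hfin
  have hEF : ∀ t, E t * F t = 1 := fun t => by
    simp only [hE, hF, smul_neg]; exact exp_mul_exp_neg _
  have hF' : HasRightDeriv F (fun t => F t * -A) := hF ▸ hasRightDeriv_exp (-A)
  have hF0 : F 0 = 1 := by simp [hF]
  clear hF hΓ
  obtain ⟨N, hN⟩ : ∃ N : ℝ → Matrix (Fin n) (Fin n) ℝ,
    N = fun t => Q + (c : ℝ) • O t - (s / τ) • t • (1 : Matrix (Fin n) (Fin n) ℝ) := ⟨_, rfl⟩
  have hN' : HasRightDeriv N (fun t => (c : ℝ) • ((E t)ᵀ * G t * E t) - (s / τ) • 1) := by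
    rw [hN]
    exact (((HasRightDeriv.matrix_const Q).add (hO.const_smul c)).sub
      ((HasRightDeriv.id_smul 1).const_smul (s / τ))).congr_deriv fun t _ => by rw [zero_add]
  have hNs : ∀ t, 0 ≤ t → (N t)ᵀ = N t := fun t ht => by
    simp only [hN, Matrix.transpose_sub, Matrix.transpose_add, Matrix.transpose_smul,
      Matrix.transpose_one, (hOpos t ht).transpose_eq, hQ.posSemidef.transpose_eq]
  have hN0 : N 0 = Q := by simp [hN, hO0]
  have hNτ : N τ = Q + (c : ℝ) • O τ - s • 1 := by
    simp only [hN, smul_smul, div_mul_cancel₀ _ hτ.ne']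
  clear hN
  obtain ⟨K, hK⟩ := exists_norm_le_of_continuousOn
    ((((hN'.mul hF').mul_const W).mul hF'.transpose).mul hN').cont τ
  have hK0 : 0 ≤ K := (norm_nonneg _).trans (hK 0 ⟨le_rfl, hτ.le⟩)
  -- The first bound keeps `(1 - δ c) G` nonnegative, the second makes `δ N F W Fᵀ N` at most `s /
  -- τ`, by the bound `K` over one period.
  obtain ⟨δ, hδ0, hδc, hδK⟩ : ∃ δ : ℝ, 0 < δ ∧ δ * c ≤ 1 ∧ δ * (n * K) ≤ s / τ := by
    refine ⟨min (1 / ((c : ℝ) + 1)) ((s / τ) / (n * K + 1)), by positivity, ?_, ?_⟩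
    · have h1 : min (1 / ((c : ℝ) + 1)) ((s / τ) / (n * K + 1)) ≤ 1 / ((c : ℝ) + 1) := min_le_left _ _
      have h2 := (le_div_iff₀ (by positivity)).mp h1
      have h3 : 0 ≤ min (1 / ((c : ℝ) + 1)) ((s / τ) / (n * K + 1)) := by positivity
      linarith
    · have h1 : min (1 / ((c : ℝ) + 1)) ((s / τ) / (n * K + 1)) ≤ (s / τ) / (n * K + 1) :=
        min_le_right _ _
      have h2 := (le_div_iff₀ (by positivity)).mp h1
      have h3 : 0 ≤ min (1 / ((c : ℝ) + 1)) ((s / τ) / (n * K + 1)) := by positivity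
      linarith
  have hsmall : ∀ t ∈ Icc 0 τ, ((s / τ) • (1 : Matrix (Fin n) (Fin n) ℝ)
      - δ • (N t * F t * W * (F t)ᵀ * N t)).PosSemidef := fun t ht =>
    posSemidef_smul_one_sub (by simp only [Matrix.transpose_mul, Matrix.transpose_transpose,
      hNs t ht.1, hW.transpose_eq, mul_assoc]) hδ0.le (hK t ht) hδK
  have hQδ : (δ • Q).PosDef := hQ.smul hδ0
  obtain ⟨X, U, hX0, hX⟩ := hG.exists_closedLoop (A := A) hW (hQδ.inv).posSemidef
  have hX0' : (X 0).PosSemidef := hX0 ▸ hQδ.inv.posSemidef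
  have hP0 : δ • ((F 0)ᵀ * N 0 * F 0) = δ • Q := by simp [hN0, hF0]
  refine ⟨X, U, hX, hX0', ?_⟩
  refine hX.posSemidef_sub_of_subsolution hG hW hX0' (P := fun t => δ • ((F t)ᵀ * N t * F t))
    (hasRightDeriv_transported hEF hF' hN' δ) (fun t ht => ?_) hτ.le (fun t ht => ?_) ?_ ?_ ?_
  · simp only [Matrix.transpose_smul, Matrix.transpose_mul, Matrix.transpose_transpose,
      hNs t ht, mul_assoc]
  -- The residual of the subsolution inequality splits into these two nonnegative terms.
  · have h1 : (((1 - δ * c) • G t) + δ • ((F t)ᵀ * ((s / τ) • (1 : Matrix (Fin n) (Fin n) ℝ)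
        - δ • (N t * F t * W * (F t)ᵀ * N t)) * F t)).PosSemidef :=
      ((hG.posSemidef t).smul (by linarith)).add
        (((hsmall t (Ico_subset_Icc_self ht)).transpose_mul_mul (F t)).smul hδ0.le)
    convert h1 using 1
    simp only [mul_sub, sub_mul, Matrix.mul_smul, Matrix.smul_mul, mul_one, mul_assoc]
    module
  · simp only [hP0]; exact hQδ.posSemidef
  · simp only [hP0, hX0]
    exact Matrix.mul_nonsing_inv _ ((Matrix.isUnit_iff_isUnit_det _).mp hQδ.isUnit)
  · simp only [hP0]
    have h1 := (hfin.transpose_mul_mul (F τ)).smul hδ0.le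
    convert h1 using 1
    have h2 : (F τ)ᵀ * (Q - (E τ)ᵀ * Q * E τ + (c : ℝ) • O τ - s • 1) * F τ
        = (F τ)ᵀ * N τ * F τ - Q := by
      have h3 : (F τ)ᵀ * ((E τ)ᵀ * Q * E τ) * F τ = Q := by
        calc _ = ((F τ)ᵀ * (E τ)ᵀ) * Q * (E τ * F τ) := by noncomm_ring
          _ = Q := by rw [← Matrix.transpose_mul, hEF, Matrix.transpose_one, one_mul, mul_one]
      have h4 : Q - (E τ)ᵀ * Q * E τ + (c : ℝ) • O τ - s • 1 = N τ - (E τ)ᵀ * Q * E τ := by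
        rw [hNτ]; abel
      rw [h4, mul_sub, sub_mul, h3]
    rw [h2, smul_sub]

end Matrix

/-! ### The switching policies -/

namespace Decomposition

variable {N M : ℕ} {P : Matrix (Fin N) (Fin M) ℝ} (S : Decomposition P)

/-- The part of a period used by the first `m` assignments. -/
def partialSum (m : ℕ) : ℝ := ∑ k : Fin S.K with k.val < m, S.φ k

theorem partialSum_zero : S.partialSum 0 = 0 := by simp [partialSum]

theorem partialSum_last : S.partialSum S.K = 1 := by simp [partialSum, S.φ_sum]

theorem partialSum_mono {k l : ℕ} (h : k ≤ l) : S.partialSum k ≤ S.partialSum l :=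
  Finset.sum_le_sum_of_subset_of_nonneg
    (Finset.monotone_filter_right _ fun _ _ ha => ha.trans_le h) fun k _ _ => (S.φ_pos k).le

theorem sum_Iio (k : Fin S.K) : ∑ k₁ ∈ Finset.Iio k, S.φ k₁ = S.partialSum k := by
  rw [partialSum]
  congr 1
  ext a
  simp

theorem sum_Iic (k : Fin S.K) : ∑ k₁ ∈ Finset.Iic k, S.φ k₁ = S.partialSum (k + 1) := by
  rw [partialSum]
  congr 1
  ext a
  simp

theorem partialSum_lt (k : Fin S.K) : S.partialSum k < S.partialSum (k + 1) := by
  rw [← S.sum_Iio, ← S.sum_Iic, ← Finset.Iio_insert, Finset.sum_insert (by simp)]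
  linarith [S.φ_pos k]

theorem isActive_iff {ε t : ℝ} {k : Fin S.K} : S.IsActive ε t k ↔ ∃ l : ℤ,
    (l + S.partialSum k) * ε ≤ t ∧ t < (l + S.partialSum (k + 1)) * ε := by
  simp only [IsActive, sum_Iio, sum_Iic]

theorem IsActive.unique {S : Decomposition P} {ε t : ℝ} (hε : 0 < ε) {k k' : Fin S.K}
    (h : S.IsActive ε t k) (h' : S.IsActive ε t k') : k = k' := by
  wlog hkk : k ≤ k' generalizing k k'
  · exact (this h' h (le_of_not_ge hkk)).symm
  by_contra hne
  have hlt : k.val + 1 ≤ k'.val := lt_of_le_of_ne hkk hne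
  obtain ⟨l, h1, h2⟩ := S.isActive_iff.mp h
  obtain ⟨l', h1', h2'⟩ := S.isActive_iff.mp h'
  have a1 := lt_of_mul_lt_mul_right (h1.trans_lt h2') hε.le
  have a2 := lt_of_mul_lt_mul_right (h1'.trans_lt h2) hε.le
  have b1 := S.partialSum_mono hlt
  have b2 := S.partialSum_mono (Nat.zero_le k)
  have b3 := S.partialSum_mono k'.isLt
  rw [partialSum_zero] at b2
  rw [Nat.succ_eq_add_one, partialSum_last] at b3
  have c1 : l' < l := by exact_mod_cast (by linarith : (l' : ℝ) < l)
  have c2 : l < l' + 1 := by exact_mod_cast (by linarith : (l : ℝ) < l' + 1)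
  lia

theorem isActive_add_period (ε t : ℝ) (k : Fin S.K) :
    S.IsActive ε (t + ε) k ↔ S.IsActive ε t k := by
  simp only [isActive_iff]
  constructor
  · rintro ⟨l, h1, h2⟩
    exact ⟨l - 1, by push_cast; linarith, by push_cast; linarith⟩
  · rintro ⟨l, h1, h2⟩
    exact ⟨l + 1, by push_cast; linarith, by push_cast; linarith⟩

/-- The entry of the `k`-th assignment for plant `i` and sensor `j`. -/
def entry (k : Fin S.K) (i : Fin N) (j : Fin M) : ℝ :=
  S.B k (Fin.castLE (le_max_left N M) i) (Fin.castLE (le_max_right N M) j)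

theorem eq_sum_entry (i : Fin N) (j : Fin M) : P i j = ∑ k, S.φ k * S.entry k i j := by
  have h := congrFun (congrFun S.sum_eq (Fin.castLE (le_max_left N M) i))
    (Fin.castLE (le_max_right N M) j)
  simpa [padded, Matrix.sum_apply, entry] using h

theorem policy_of_isActive {ε t : ℝ} (hε : 0 < ε) {k : Fin S.K} (h : S.IsActive ε t k)
    (i : Fin N) (j : Fin M) : S.policy ε i j t = S.entry k i j := by
  rw [policy, Finset.sum_eq_single k (fun k' _ hk' => if_neg fun h' => hk' (h'.unique hε h))
    (by simp), if_pos h, entry]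

theorem policy_mem {ε : ℝ} (hε : 0 < ε) (i : Fin N) (j : Fin M) (t : ℝ) :
    S.policy ε i j t ∈ ({0, 1} : Set ℝ) := by
  by_cases h : ∃ k, S.IsActive ε t k
  · obtain ⟨k, hk⟩ := h
    rw [S.policy_of_isActive hε hk]
    exact (S.B_assignment k).zero_or_one _ _
  · push Not at h
    left
    exact Finset.sum_eq_zero fun k _ => if_neg (h k)

theorem policy_periodic (ε : ℝ) (i : Fin N) (j : Fin M) :
    Function.Periodic (S.policy ε i j) ε := fun t => by
  classical
  exact Finset.sum_congr rfl fun k _ => if_congr (S.isActive_add_period ε t k) rfl rfl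

end Decomposition

namespace Model

variable {N M : ℕ} {D : Model N M} {P : Matrix (Fin N) (Fin M) ℝ} (S : Decomposition P)

theorem Assumptions.posSemidef_information (hD : D.Assumptions) (i : Fin N) {q : Fin M → ℝ}
    (hq : ∀ j, 0 ≤ q j) : (D.information i q).PosSemidef := by
  refine Matrix.posSemidef_sum _ fun j _ => Matrix.PosSemidef.smul ?_ (hq j)
  have := (hD.V_posDef i j).inv.posSemidef.conjTranspose_mul_mul_same (D.C i j)
  rwa [Matrix.conjTranspose_eq_transpose_of_trivial] at this

theorem Assumptions.isSwitching (hD : D.Assumptions) (i : Fin N) {ε : ℝ} (hε : 0 < ε) :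
    IsSwitching ε fun t => D.information i fun j => S.policy ε i j t where
  pos := hε
  periodic t := by simp only [S.policy_periodic ε i _ t]
  posSemidef t := hD.posSemidef_information i fun j => by
    rcases S.policy_mem hε i j t with h | h
    · exact h.ge
    · exact zero_le_one.trans h.ge
  finite_range := by
    refine ((Set.Finite.pi' fun _ : Fin M => (finite_singleton (1 : ℝ)).insert 0).image
      (D.information i)).subset ?_
    rintro _ ⟨t, rfl⟩
    exact ⟨_, fun j => S.policy_mem hε i j t, rfl⟩
  piecewise := by
    refine ⟨S.K, fun k => S.partialSum k * ε, by simp [S.partialSum_zero],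
      by simp [S.partialSum_last],
      fun k => mul_le_mul_of_nonneg_right (S.partialSum_mono k.le_succ) hε.le, fun k hk =>
      ⟨D.information i (S.entry ⟨k, hk⟩ i), fun t ht => ?_⟩⟩
    have : S.IsActive ε t ⟨k, hk⟩ := S.isActive_iff.mpr ⟨0, by simpa using ht.1, by simpa using ht.2⟩
    simp only [S.policy_of_isActive hε this]

/-- The weight `φ k` is the share of the period spent on the `k`-th assignment, so the relaxed
information matrix is the time average of the switched one. -/
theorem information_eq_sum (i : Fin N) :
    D.information i (P i) = ∑ k, S.φ k • D.information i (S.entry k i) := by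
  simp only [information, Finset.smul_sum, smul_smul]
  rw [Finset.sum_comm]
  refine Finset.sum_congr rfl fun j _ => ?_
  rw [S.eq_sum_entry i j, Finset.sum_smul]

end Model

section Matrix

attribute [local instance] Matrix.linftyOpNormedRing Matrix.linftyOpNormedAlgebra

/-- Identity theorem for the outputs of an autonomous linear system. -/
theorem mulVec_exp_eq_zero {n : ℕ} {A H : Matrix (Fin n) (Fin n) ℝ} {x : Fin n → ℝ} {a b : ℝ}
    (hab : a < b) (h : ∀ t ∈ Ico a b, H *ᵥ (NormedSpace.exp (t • A) *ᵥ x) = 0) (t : ℝ) :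
    H *ᵥ (NormedSpace.exp (t • A) *ᵥ x) = 0 := by
  let l : Matrix (Fin n) (Fin n) ℝ →L[ℝ] (Fin n → ℝ) := LinearMap.toContinuousLinearMap
    (H.mulVecLin ∘ₗ (Matrix.mulVecBilin ℝ ℝ).flip x)
  have hf : AnalyticOnNhd ℝ (fun t : ℝ => l (NormedSpace.exp (t • A))) univ := fun t _ =>
    (l.analyticAt _).comp ((NormedSpace.exp_analytic (𝕂 := ℝ) (t • A)).comp
      (f := fun t : ℝ => t • A) (analyticAt_id.smul analyticAt_const))
  refine hf.eqOn_zero_of_preconnected_of_eventuallyEq_zero isPreconnected_univ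
    (mem_univ ((a + b) / 2)) ?_ (mem_univ t)
  have hmem : Ico a b ∈ 𝓝 ((a + b) / 2) := Ico_mem_nhds (by linarith) (by linarith)
  filter_upwards [hmem] with s hs
  exact h s hs

end Matrix

/-! ### From the semidefinite program to the Riccati inequality, and the output matrices. -/

namespace Model

variable {N M : ℕ} {D : Model N M} {P : Matrix (Fin N) (Fin M) ℝ} (S : Decomposition P)

/-- Each assignment is active on an interval of positive length. An output that vanishes there
vanishes for all times by analyticity, whatever the period is. -/
theorem information_mulVec_exp_eq_zero (i : Fin N) {ε : ℝ} (hε : 0 < ε) {x : Fin (D.n i) → ℝ}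
    (h : ∀ t ∈ Ico 0 ε, (D.information i fun j => S.policy ε i j t) *ᵥ
      (NormedSpace.exp (t • D.A i) *ᵥ x) = 0) (t : ℝ) :
    D.information i (P i) *ᵥ (NormedSpace.exp (t • D.A i) *ᵥ x) = 0 := by
  rw [information_eq_sum S, Matrix.sum_mulVec]
  refine Finset.sum_eq_zero fun k _ => ?_
  rw [Matrix.smul_mulVec]
  refine smul_eq_zero_of_right _ (mulVec_exp_eq_zero
    (mul_lt_mul_of_pos_right (S.partialSum_lt k) hε) (fun t ht => ?_) t)
  have hk : S.IsActive ε t k := S.isActive_iff.mpr ⟨0, by simpa using ht.1, by simpa using ht.2⟩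
  have h0 : 0 ≤ S.partialSum k * ε := by
    have := S.partialSum_mono (Nat.zero_le k)
    rw [S.partialSum_zero] at this
    positivity
  have h1 : S.partialSum (k + 1) * ε ≤ ε := by
    have := S.partialSum_mono k.isLt
    rw [Nat.succ_eq_add_one, S.partialSum_last] at this
    nlinarith
  have := h t ⟨h0.trans ht.1, ht.2.trans_le h1⟩
  simpa only [S.policy_of_isActive hε hk] using this

theorem IsFeasible.posDef {R Q : ∀ i, Matrix (Fin (D.n i)) (Fin (D.n i)) ℝ}
    (h : D.IsFeasible R Q P) (i : Fin N) : (Q i).PosDef := by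
  have := (h.inverse_lmi i).submatrix (Sum.inr_injective (α := Fin (D.n i)))
  exact this

/-- This is the Schur complement of the negated matrix inequality with respect to its lower right
block, which is the identity. -/
theorem IsFeasible.posSemidef {R Q : ∀ i, Matrix (Fin (D.n i)) (Fin (D.n i)) ℝ}
    (h : D.IsFeasible R Q P) (hD : D.Assumptions) (i : Fin N) :
    (D.information i (P i) - Q i * D.A i - (D.A i)ᵀ * Q i - Q i * D.W i * Q i).PosSemidef := by
  have h1 := h.riccati_lmi i
  have hQ := (h.posDef i).posSemidef.transpose_eq
  have h2 : -(CFC.sqrt (D.W i) * Q i) = (-(Q i * CFC.sqrt (D.W i)))ᴴ := by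
    rw [Matrix.conjTranspose_eq_transpose_of_trivial, Matrix.transpose_neg, Matrix.transpose_mul,
      sqrt_isSymm, hQ]
  rw [Matrix.fromBlocks_neg, h2, neg_neg] at h1
  let _ : Invertible (1 : Matrix (Fin (D.n i)) (Fin (D.n i)) ℝ) := invertibleOne
  have := (Matrix.PosDef.fromBlocks₂₂ _ _ Matrix.PosDef.one).mp h1
  rw [← h2, inv_one, mul_one] at this
  have h3 : D.information i (P i) - Q i * D.A i - (D.A i)ᵀ * Q i - Q i * D.W i * Q i
      = -(Q i * D.A i + (D.A i)ᵀ * Q i - D.information i (P i))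
        - -(Q i * CFC.sqrt (D.W i)) * -(CFC.sqrt (D.W i) * Q i) := by
    have h4 : Q i * D.W i * Q i = Q i * (CFC.sqrt (D.W i) * CFC.sqrt (D.W i)) * Q i := by
      rw [sqrt_mul_self (hD.W_posSemidef i)]
    rw [h4]
    noncomm_ring
  rw [h3]
  exact this

/-- The matrix of all the normalised outputs `V_{ij}^{-1/2} C_{ij}` of plant `i`. -/
def fullOutput (D : Model N M) (i : Fin N) :
    Matrix ((j : Fin M) × Fin (D.m i j)) (Fin (D.n i)) ℝ :=
  fun r c => (CFC.sqrt (D.V i r.1)⁻¹ * D.C i r.1) r.2 c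

theorem Assumptions.sum_normalised (hD : D.Assumptions) (i : Fin N) (j : Fin M)
    (a b : Fin (D.n i)) :
    ∑ r, (CFC.sqrt (D.V i j)⁻¹ * D.C i j) r a * (CFC.sqrt (D.V i j)⁻¹ * D.C i j) r b
      = ((D.C i j)ᵀ * (D.V i j)⁻¹ * D.C i j) a b := by
  have h : (D.C i j)ᵀ * (D.V i j)⁻¹ * D.C i j
      = (CFC.sqrt (D.V i j)⁻¹ * D.C i j)ᵀ * (CFC.sqrt (D.V i j)⁻¹ * D.C i j) := by
    rw [Matrix.transpose_mul, sqrt_isSymm, ← Matrix.mul_assoc, Matrix.mul_assoc (D.C i j)ᵀ (CFC.sqrt _),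
      sqrt_mul_self (hD.V_posDef i j).inv.posSemidef]
  rw [h, Matrix.mul_apply]
  rfl

/-- The left factor does not depend on time, so an injection `Z(t)` times it is continuous although
the policy jumps, and still produces the closed loop `A - Z G`. -/
theorem Assumptions.fullOutput_mul (hD : D.Assumptions) (ε : ℝ) (i : Fin N) (t : ℝ) :
    (D.fullOutput i)ᵀ * D.outputMatrix S ε i t = D.information i fun j => S.policy ε i j t := by
  ext a b
  rw [Matrix.mul_apply]
  simp only [Matrix.transpose_apply, fullOutput, outputMatrix, information,
    Fintype.sum_sigma, Matrix.sum_apply, Matrix.smul_apply, smul_eq_mul]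
  refine Finset.sum_congr rfl fun j _ => ?_
  rw [← hD.sum_normalised i j a b, Finset.mul_sum]
  exact Finset.sum_congr rfl fun r _ => by ring

/-- The policy takes only the values `0` and `1`, so its square is itself. -/
theorem Assumptions.outputMatrix_mul (hD : D.Assumptions) {ε : ℝ} (hε : 0 < ε) (i : Fin N)
    (t : ℝ) : (D.outputMatrix S ε i t)ᵀ * D.outputMatrix S ε i t
      = D.information i fun j => S.policy ε i j t := by
  rw [← hD.fullOutput_mul S]
  ext a b
  rw [Matrix.mul_apply, Matrix.mul_apply]
  simp only [Matrix.transpose_apply, fullOutput, outputMatrix]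
  refine Finset.sum_congr rfl fun r _ => ?_
  rcases S.policy_mem hε i r.1 t with h | h <;> rw [h] <;> ring

end Model

end SensorScheduling

end

theorem mainTheorem4 {N M : ℕ} (D : SensorScheduling.Model N M) (hD : D.Assumptions)
    (P : Matrix (Fin N) (Fin M) ℝ) (hP : D.IsOptimal P)
    (S : SensorScheduling.Decomposition P) (ε : ℝ) (hε : 0 < ε) (i : Fin N) :
    SensorScheduling.IsPeriodicDetectable ε (D.A i) (D.outputMatrix S ε i) ∧
    (∃ X : ℝ → Matrix (Fin (D.n i)) (Fin (D.n i)) ℝ, D.IsErrorCovariance S ε i X) ∧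
    ∃ Xbar : ℝ → Matrix (Fin (D.n i)) (Fin (D.n i)) ℝ,
      SensorScheduling.IsStrongPeriodicSolution ε (D.A i) (D.W i) (D.outputMatrix S ε i) Xbar ∧
      (∀ Y : ℝ → Matrix (Fin (D.n i)) (Fin (D.n i)) ℝ,
        SensorScheduling.IsStrongPeriodicSolution ε (D.A i) (D.W i) (D.outputMatrix S ε i) Y →
          Y = Xbar) ∧
      ∀ X : ℝ → Matrix (Fin (D.n i)) (Fin (D.n i)) ℝ, D.IsErrorCovariance S ε i X →
        Tendsto (fun t => X t - Xbar t) atTop (𝓝 0) := by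
  obtain ⟨⟨R, Q, hF⟩, -⟩ := hP
  have hW := hD.W_posSemidef i
  have hc := hD.controllable i
  have hG := hD.isSwitching S i hε
  have hO := hD.outputMatrix_mul S hε i
  obtain ⟨X₁, U₁, h₁, h₁0, h₁d⟩ := hG.exists_decreasing hW hc (hF.posDef i) (hF.posSemidef hD i)
    fun x hx t _ => D.information_mulVec_exp_eq_zero S i hε hx t
  obtain ⟨Z, hZc, hZp, hZpos, hZd, ⟨Φ, hΦ, hμ⟩, hZt⟩ := h₁.exists_attracting hG hW hc h₁0 h₁d
  refine ⟨⟨fun t => Z t * (D.fullOutput i)ᵀ, hZc.matrix_mul continuous_const,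
    fun t => by simp only [hZp t], Φ, ?_, hμ⟩, ?_, Z, ⟨hZc, hZp, hZpos, ?_, ?_⟩, ?_, ?_⟩
  · simpa only [Matrix.mul_assoc, hD.fullOutput_mul S] using hΦ
  · obtain ⟨X, U, hX0, hX⟩ := hG.exists_closedLoop (A := D.A i) hW (hD.Sigma0_posDef i).posSemidef
    exact ⟨X, hX0, hX.riccati.cont, hX.riccati.deriv⟩
  · simpa only [hO] using hZd
  · exact ⟨Φ, by simpa only [hO] using hΦ, fun μ h => (hμ μ h).le⟩
  · intro Y hY
    have hYd : SensorScheduling.HasRightDeriv Y fun t => SensorScheduling.riccati (D.A i) (D.W i)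
        (D.information i fun j => S.policy ε i j t) (Y t) :=
      ⟨hY.continuous.continuousOn, fun t _ => by simpa only [hO] using hY.deriv_right t⟩
    obtain ⟨U, hU⟩ := hG.exists_adjoint hW hYd (hY.posSemidef 0)
    -- Controllability makes `Y` positive definite after one period, and periodicity carries this
    -- back to time `0`.
    have hY0 : (Y 0).PosDef := by
      have := hU.posDef hG hW hc (hY.posSemidef 0) hε
      rwa [← zero_add ε, hY.periodic 0] at this
    have ht := hZt Y hYd hY0
    funext t
    -- Along `t + k ε` the difference of the two periodic solutions is constant and tends to zero.
    have h1 : Tendsto (fun k : ℕ => Y (t + k * ε) - Z (t + k * ε)) atTop (𝓝 0) :=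
      ht.comp (tendsto_atTop_add_const_left _ t
        (tendsto_natCast_atTop_atTop.atTop_mul_const hε))
    have h2 : (fun k : ℕ => Y (t + k * ε) - Z (t + k * ε)) = fun _ => Y t - Z t := by
      funext k
      rw [hY.periodic.nat_mul k t, hZp.nat_mul k t]
    rw [h2] at h1
    exact sub_eq_zero.mp (tendsto_nhds_unique tendsto_const_nhds h1)
  · intro X hX
    exact hZt X ⟨hX.continuousOn, hX.deriv_right⟩ (hX.initial ▸ hD.Sigma0_posDef i)
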